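/- Let $E=(E^0,E^1,r,s)$ be a finite quiver, and let $\le$ be a pre-order on $E^0$ such that $v\le w$ whenever there is a (directed) path from $w$ to $v$. Let $I$ be the antisymmetrization of $(E^0,\le)$ with its induced partial order, and write $[v]\in I$ for the class of $v\in E^0$. Assume that $I$ is a tree, i.e. $I$ has a maximum $i_0$ and for every $i\in I$ the interval $[i,i_0]$ is a chain. Let $\mathbf K=\{K_i\}_{i\in I}$ be a poset of fields, i.e. a family of fields with compatible embeddings $K_j\subseteq K_i$ whenever $i\le j$. Let $P_{\mathbf K}((E))$ be the ring of formal power series $\sum_{\gamma} a_\gamma\gamma$ over all paths $\gamma$ of $E$ (the vertices being the paths of length $0$), with $a_\gamma\in K_{[r(\gamma)]}$ and the usual multiplication (the coefficient of $\gamma$ in $ab$ is $\sum_{\gamma=\alpha\beta}a_\alpha b_\beta$); let $P_{\mathbf K}(E)$ be its subring of series with finite support; and let $\epsilon\colon P_{\mathbf K}((E))\to\mathcal E=\bigoplus_{v\in E^0}K_{[v]}v$ be the augmentation, which keeps the coefficients at the paths of length $0$. Let $\Sigma$ be the set of all square matrices over $P_{\mathbf K}(E)$ that are sent by $\epsilon$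 to invertible matrices over $\mathcal E$, and let $P_{\mathbf K}(E)\Sigma^{-1}$ be the universal localization. For a field $K$ and a finite quiver $F$, let $P_K((F))$ and $P_K(F)$ be the usual power series and path algebras (all coefficients in $K$) and let $P^{\rm rat}_K(F)$ be the division closure of $P_K(F)$ in $P_K((F))$, i.e. the smallest subring that contains $P_K(F)$ and contains the inverse of each of its elements that is invertible in $P_K((F))$. For $i\in I$ let $E_{I\downarrow i}$ be the full subquiver of $E$ on the vertices $v$ with $[v]\le i$; then $P_{K_i}((E_{I\downarrow i}))\subseteq P_{\mathbf K}((E))$. For non-empty lower subsets $J$ of $I$, define additive subgroups $P^{\rm rat}_J(E)\subseteq P_{\mathbf K}((E))$ inductively: if $J$ consists of minimal elements of $I$, then $P^{\rm rat}_J(E)=\bigoplus_{i\in J}P^{\rm rat}_{K_i}(E_{I\downarrow i})$ (and here $E_{I\downarrow i}=E_{\{i\}}$); and if $J\ne I$, $i$ is a minimal element of $I\setminus J$ and $J'=J\cup\{i\}$, then $$P^{\rm rat}_{J'}(E)=P^{\rm rat}_{K_i}(E_{I\downarrow i})+P^{\rm rat}_{K_i}(E_{I\downarrow i})\,P^{\rm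 rat}_J(E)+P^{\rm rat}_J(E),$$ where the product denotes the set of finite sums of products. Put $P^{\rm rat}_{\mathbf K}(E):=P^{\rm rat}_I(E)$. Then $P^{\rm rat}_{\mathbf K}(E)$ is well defined (independent of the choices made in the induction), it is a subring of $P_{\mathbf K}((E))$, and it is the rational closure of $P_{\mathbf K}(E)$ in $P_{\mathbf K}((E))$, i.e. the smallest subring $T\supseteq P_{\mathbf K}(E)$ such that every square matrix over $T$ that is invertible over $P_{\mathbf K}((E))$ has its inverse over $T$. Moreover there is a unique ring homomorphism $P_{\mathbf K}(E)\Sigma^{-1}\to P^{\rm rat}_{\mathbf K}(E)$ compatible with the canonical maps from $P_{\mathbf K}(E)$, and it is an isomorphism. -/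

import Mathlib

universe u v w

namespace PosetFields

section RingTheory

/-- A subring `T` of `S` is *division closed* if the inverse in `S` of every element of `T` that is
invertible in `S` lies in `T`. -/
def IsDivisionClosed {S : Type u} [Ring S] (T : Subring S) : Prop :=
  ∀ x ∈ T, ∀ y : S, x * y = 1 → y * x = 1 → y ∈ T

/-- A subring `T` of `S` is *rationally closed* if the inverse over `S` of every square matrix over
`T` that is invertible over `S` has all its entries in `T`. -/
def IsRationallyClosed {S : Type u} [Ring S] (T : Subring S) : Prop :=
  ∀ (n : ℕ) (A B : Matrix (Fin n) (Fin n) S), (∀ i j, A i j ∈ T) → A * B = 1 → B * A = 1 →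
    ∀ i j, B i j ∈ T

/-- The division closure of `R` in `S`: the smallest division closed subring containing `R`. -/
def divisionClosure {S : Type u} [Ring S] (R : Subring S) : Subring S :=
  sInf {T | R ≤ T ∧ IsDivisionClosed T}

/-- The rational closure of `R` in `S`: the smallest rationally closed subring containing `R`. -/
def rationalClosure {S : Type u} [Ring S] (R : Subring S) : Subring S :=
  sInf {T | R ≤ T ∧ IsRationallyClosed T}

/-! The universal localization `R Σ⁻¹` of a ring at a set `Σ` of square matrices, by generators and
relations. -/

/-- Generators of `R Σ⁻¹`: the elements of `R`, and the entries of a formal inverse of each matrix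
in `Σ`. -/
inductive LocGen (R : Type u) (Sig : ∀ n : ℕ, Set (Matrix (Fin n) (Fin n) R)) : Type u
  | coeff (r : R) : LocGen R Sig
  | inv (n : ℕ) (A : Sig n) (i j : Fin n) : LocGen R Sig

open LocGen in
/-- Relations of `R Σ⁻¹`: those of `R`, and those saying that the formal inverses are two-sided
inverses. -/
inductive LocRel (R : Type u) [Ring R] (Sig : ∀ n : ℕ, Set (Matrix (Fin n) (Fin n) R)) :
    FreeAlgebra ℤ (LocGen R Sig) → FreeAlgebra ℤ (LocGen R Sig) → Prop
  | one : LocRel R Sig (FreeAlgebra.ι ℤ (coeff 1)) 1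
  | add (r s : R) : LocRel R Sig (FreeAlgebra.ι ℤ (coeff (r + s)))
      (FreeAlgebra.ι ℤ (coeff r) + FreeAlgebra.ι ℤ (coeff s))
  | mul (r s : R) : LocRel R Sig (FreeAlgebra.ι ℤ (coeff (r * s)))
      (FreeAlgebra.ι ℤ (coeff r) * FreeAlgebra.ι ℤ (coeff s))
  | mul_inv (n : ℕ) (A : Sig n) (i j : Fin n) : LocRel R Sig
      (∑ k, FreeAlgebra.ι ℤ (coeff (A.1 i k)) * FreeAlgebra.ι ℤ (inv n A k j))
      (if i = j then 1 else 0)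
  | inv_mul (n : ℕ) (A : Sig n) (i j : Fin n) : LocRel R Sig
      (∑ k, FreeAlgebra.ι ℤ (inv n A i k) * FreeAlgebra.ι ℤ (coeff (A.1 k j)))
      (if i = j then 1 else 0)

/-- The universal localization `R Σ⁻¹`. -/
abbrev UnivLoc (R : Type u) [Ring R] (Sig : ∀ n : ℕ, Set (Matrix (Fin n) (Fin n) R)) : Type u :=
  RingQuot (LocRel R Sig)

/-- The canonical ring homomorphism `R → R Σ⁻¹`. -/
noncomputable def UnivLoc.of {R : Type u} [Ring R]
    (Sig : ∀ n : ℕ, Set (Matrix (Fin n) (Fin n) R)) : R →+* UnivLoc R Sig :=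
  RingHom.mk'
    { toFun := fun r => RingQuot.mkRingHom (LocRel R Sig) (FreeAlgebra.ι ℤ (LocGen.coeff r))
      map_one' := by rw [RingQuot.mkRingHom_rel LocRel.one, map_one]
      map_mul' := fun r s => by rw [RingQuot.mkRingHom_rel (LocRel.mul r s), map_mul] }
    (fun r s => by
      change RingQuot.mkRingHom (LocRel R Sig) _ = RingQuot.mkRingHom (LocRel R Sig) _ +
        RingQuot.mkRingHom (LocRel R Sig) _
      rw [RingQuot.mkRingHom_rel (LocRel.add r s), map_add])

end RingTheory

/-- A poset `I` is a *tree* if it has a maximum `i₀` and every interval `[i, i₀]` is a chain. -/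
def IsTreePoset (I : Type u) [PartialOrder I] : Prop :=
  ∃ i₀ : I, IsTop i₀ ∧ ∀ i : I, IsChain (· ≤ ·) (Set.Icc i i₀)

/-- A poset of fields over `I`: fields `K_i` with compatible embeddings `K_j ⊆ K_i` for `i ≤ j`. -/
structure PosetOfFields (I : Type u) [PartialOrder I] where
  fld : I → Type w
  [field : ∀ i, Field (fld i)]
  incl : ∀ {i j : I}, i ≤ j → fld j →+* fld i
  incl_refl : ∀ (i : I) (x : fld i), incl (le_refl i) x = x
  incl_trans : ∀ {i j k : I} (hij : i ≤ j) (hjk : j ≤ k) (x : fld k),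
    incl hij (incl hjk x) = incl (hij.trans hjk) x

attribute [instance] PosetOfFields.field

/-- The constant poset of fields. -/
def PosetOfFields.const (I : Type u) [PartialOrder I] (F : Type w) [Field F] :
    PosetOfFields.{u, w} I where
  fld := fun _ => F
  incl := fun _ => RingHom.id F
  incl_refl := fun _ _ => rfl
  incl_trans := fun _ _ _ => rfl

/-- The pre-order on the vertices is compatible with the quiver: `x ≤ y` whenever there is a path
from `y` to `x`. -/
class PathCompatible (V : Type u) [Quiver.{v} V] [Preorder V] : Prop where
  le_of_path : ∀ {y x : V}, Quiver.Path y x → x ≤ y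

/-- The poset `I`: the antisymmetrization of the set of vertices. -/
abbrev Comp (V : Type u) [Preorder V] : Type u := Antisymmetrization V (· ≤ ·)

/-- The component `[x]` of a vertex. -/
abbrev comp {V : Type u} [Preorder V] (x : V) : Comp V := toAntisymmetrization (· ≤ ·) x

section Splits

variable {V : Type u} [Quiver.{v} V]

/-- The list of all factorizations `γ = α β` of a path (see `mem_splits` and `nodup_splits`). -/
def splits {x : V} : ∀ {y : V}, Quiver.Path x y → List (Σ z : V, Quiver.Path x z × Quiver.Path z y)
  | _, .nil => [⟨x, .nil, .nil⟩]
  | _, .cons p e => ⟨_, .cons p e, .nil⟩ ::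
      (splits p).map (fun s => ⟨s.1, s.2.1, s.2.2.cons e⟩)

theorem mem_splits {x y : V} (γ : Quiver.Path x y)
    (s : Σ z : V, Quiver.Path x z × Quiver.Path z y) :
    s ∈ splits γ ↔ s.2.1.comp s.2.2 = γ := by
  induction γ with
  | nil =>
    obtain ⟨z, α, β⟩ := s
    simp only [splits, List.mem_singleton]
    constructor
    · rintro h
      cases h
      rfl
    · intro h
      cases β with
      | nil => cases h; rfl
      | cons β e => cases h
  | cons p e ih =>
    obtain ⟨z, α, β⟩ := s
    simp only [splits, List.mem_cons, List.mem_map]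
    constructor
    · rintro (h | ⟨⟨z', α', β'⟩, h1, h2⟩)
      · cases h
        rfl
      · cases h2
        have := (ih ⟨z', α', β'⟩).1 h1
        simp only at this
        simp [Quiver.Path.comp_cons, this]
    · intro h
      cases β with
      | nil => left; cases h; rfl
      | cons β f =>
        right
        simp only [Quiver.Path.comp_cons] at h
        cases h
        exact ⟨⟨z, α, β⟩, (ih _).2 rfl, rfl⟩

theorem nodup_splits {x y : V} (γ : Quiver.Path x y) : (splits γ).Nodup := by
  induction γ with
  | nil => simp [splits]
  | cons p e ih =>
    rw [splits, List.nodup_cons]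
    constructor
    · simp only [List.mem_map, not_exists, not_and]
      rintro ⟨z, α, β⟩ - h
      have h1 := congrArg (fun s : (Σ z : V, Quiver.Path _ z × Quiver.Path z _) =>
        s.2.2.length) h
      simp at h1
    · refine ih.map ?_
      rintro ⟨z, α, β⟩ ⟨z', α', β'⟩ h
      simp only [Sigma.mk.injEq] at h
      obtain ⟨rfl, h⟩ := h
      have h := eq_of_heq h
      simp only [Prod.mk.injEq] at h
      obtain ⟨rfl, h⟩ := h
      cases h
      rfl

theorem sum_splits_assoc {M : Type w} [AddCommMonoid M] {x y : V} (γ : Quiver.Path x y)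
    (f : ∀ z t : V, Quiver.Path x z → Quiver.Path z t → Quiver.Path t y → M) :
    ((splits γ).map fun s => ((splits s.2.1).map fun t => f t.1 s.1 t.2.1 t.2.2 s.2.2).sum).sum =
    ((splits γ).map fun s => ((splits s.2.2).map fun t => f s.1 t.1 s.2.1 t.2.1 t.2.2).sum).sum := by
  induction γ with
  | nil => simp [splits]
  | cons p e ih =>
    simp only [splits, List.map_cons, List.sum_cons, List.map_map, Function.comp_def,
      List.map_nil, List.sum_nil, add_zero, List.sum_map_add]
    rw [ih (fun z t α β δ => f z t α β (δ.cons e)), add_assoc]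

theorem sum_splits_left {M : Type w} [AddCommMonoid M] {x y : V} (γ : Quiver.Path x y)
    (f : ∀ z : V, Quiver.Path x z → Quiver.Path z y → M)
    (hf : ∀ (z t : V) (α : Quiver.Path x z) (e : z ⟶ t) (β : Quiver.Path t y),
      f t (α.cons e) β = 0) :
    ((splits γ).map fun s => f s.1 s.2.1 s.2.2).sum = f x .nil γ := by
  induction γ with
  | nil => simp [splits]
  | cons p e ih =>
    simp only [splits, List.map_cons, List.sum_cons, List.map_map, Function.comp_def]
    rw [hf, zero_add]
    exact ih (fun z α β => f z α (β.cons e)) (fun z t α e' β => hf z t α e' (β.cons e))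

theorem sum_splits_right {M : Type w} [AddCommMonoid M] {x y : V} (γ : Quiver.Path x y)
    (f : ∀ z : V, Quiver.Path x z → Quiver.Path z y → M)
    (hf : ∀ (z t : V) (α : Quiver.Path x z) (β : Quiver.Path z t) (e : t ⟶ y),
      f z α (β.cons e) = 0) :
    ((splits γ).map fun s => f s.1 s.2.1 s.2.2).sum = f y γ .nil := by
  cases γ with
  | nil => simp [splits]
  | cons p e =>
    simp only [splits, List.map_cons, List.sum_cons, List.map_map, Function.comp_def]
    rw [List.map_congr_left (g := fun _ => (0 : M)) (fun s _ => hf _ _ _ _ _)]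
    simp

end Splits

section Series

variable {V : Type u} [Quiver.{v} V] [Preorder V]

theorem comp_le_of_path [PathCompatible V] {x y : V} (γ : Quiver.Path x y) : comp y ≤ comp x :=
  toAntisymmetrization_le_toAntisymmetrization_iff.2 (PathCompatible.le_of_path γ)

/-- `P_K((E))`: the formal power series `∑ a_γ γ` over all paths `γ` of `E`, with
`a_γ ∈ K_[r(γ)]`. -/
def PathSeries (K : PosetOfFields.{u, w} (Comp V)) : Type (max u v w) :=
  ∀ x y : V, Quiver.Path x y → K.fld (comp y)

namespace PathSeries

variable (K : PosetOfFields.{u, w} (Comp V))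

instance : AddCommGroup (PathSeries K) :=
  inferInstanceAs (AddCommGroup (∀ x y : V, Quiver.Path x y → K.fld (comp y)))

variable {K}

@[ext]
theorem ext {a b : PathSeries K} (h : ∀ (x y : V) (γ : Quiver.Path x y), a x y γ = b x y γ) :
    a = b :=
  funext fun x => funext fun y => funext fun γ => h x y γ

@[simp] theorem add_apply (a b : PathSeries K) (x y : V) (γ : Quiver.Path x y) :
    (a + b) x y γ = a x y γ + b x y γ := rfl

@[simp] theorem zero_apply (x y : V) (γ : Quiver.Path x y) : (0 : PathSeries K) x y γ = 0 := rfl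

@[simp] theorem neg_apply (a : PathSeries K) (x y : V) (γ : Quiver.Path x y) :
    (-a) x y γ = -a x y γ := rfl

variable (K) in
/-- The coefficients of `1 = ∑_v v`. -/
def oneCoeff : ∀ x y : V, Quiver.Path x y → K.fld (comp y)
  | _, _, .nil => 1
  | _, _, .cons _ _ => 0

instance : One (PathSeries K) := ⟨oneCoeff K⟩

@[simp] theorem one_nil (x : V) : (1 : PathSeries K) x x .nil = 1 := rfl

@[simp] theorem one_cons {x y z : V} (p : Quiver.Path x y) (e : y ⟶ z) :
    (1 : PathSeries K) x z (p.cons e) = 0 := rfl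

variable [PathCompatible V]

/-- The usual multiplication of power series:
the coefficient of `γ` in `a b` is the sum of `a_α b_β` over all factorizations `γ = α β`. -/
instance : Mul (PathSeries K) :=
  ⟨fun a b x y γ => ((splits γ).map fun s =>
    K.incl (comp_le_of_path s.2.2) (a x s.1 s.2.1) * b s.1 y s.2.2).sum⟩

theorem mul_apply (a b : PathSeries K) (x y : V) (γ : Quiver.Path x y) :
    (a * b) x y γ = ((splits γ).map fun s =>
      K.incl (comp_le_of_path s.2.2) (a x s.1 s.2.1) * b s.1 y s.2.2).sum := rfl

protected theorem mul_assoc (a b c : PathSeries K) : a * b * c = a * (b * c) := by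
  ext x y γ
  simp only [mul_apply, map_list_sum, List.map_map, Function.comp_def, map_mul, K.incl_trans,
    ← List.sum_map_mul_left, ← List.sum_map_mul_right, mul_assoc]
  exact sum_splits_assoc γ (fun z t α β δ => K.incl (comp_le_of_path (β.comp δ)) (a x z α) *
    (K.incl (comp_le_of_path δ) (b z t β) * c t y δ))

protected theorem mul_one (a : PathSeries K) : a * 1 = a := by
  ext x y γ
  have h := sum_splits_right γ (fun z α β => K.incl (comp_le_of_path β) (a x z α) *
    (1 : PathSeries K) z y β) (fun z t α β e => by rw [one_cons, mul_zero])
  rw [mul_apply, h, one_nil, K.incl_refl, mul_one]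

protected theorem one_mul (a : PathSeries K) : 1 * a = a := by
  ext x y γ
  have h := sum_splits_left γ (fun z α β => K.incl (comp_le_of_path β)
    ((1 : PathSeries K) x z α) * a z y β)
    (fun z t α e β => by rw [one_cons, map_zero, zero_mul])
  rw [mul_apply, h, one_nil, map_one, one_mul]

instance : Ring (PathSeries K) :=
  { (inferInstance : AddCommGroup (PathSeries K)) with
    mul := (· * ·)
    one := 1
    mul_assoc := PathSeries.mul_assoc
    mul_one := PathSeries.mul_one
    one_mul := PathSeries.one_mul
    zero_mul := fun a => by ext x y γ; simp [mul_apply]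
    mul_zero := fun a => by ext x y γ; simp [mul_apply]
    left_distrib := fun a b c => by
      ext x y γ; simp [mul_apply, mul_add, List.sum_map_add]
    right_distrib := fun a b c => by
      ext x y γ; simp [mul_apply, add_mul, List.sum_map_add] }

/-- The set of paths whose coefficient is not zero. -/
def support (a : PathSeries K) : Set (Σ x y : V, Quiver.Path x y) :=
  {p | a p.1 p.2.1 p.2.2 ≠ 0}

theorem finite_support_mul {a b : PathSeries K} (ha : a.support.Finite) (hb : b.support.Finite) :
    (a * b).support.Finite := by
  classical
  let g : (Σ x y : V, Quiver.Path x y) × (Σ x y : V, Quiver.Path x y) →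
      (Σ x y : V, Quiver.Path x y)
    | (⟨x, z, α⟩, ⟨z', y, β⟩) => if h : z' = z then ⟨x, y, α.comp (h ▸ β)⟩ else ⟨x, z, α⟩
  refine ((ha.prod hb).image g).subset ?_
  rintro ⟨x, y, γ⟩ hγ
  have hne : (a * b) x y γ ≠ 0 := hγ
  rw [mul_apply] at hne
  obtain ⟨c, hc, hc0⟩ : ∃ c ∈ (splits γ).map (fun s :
      (Σ z : V, Quiver.Path x z × Quiver.Path z y) => K.incl (comp_le_of_path s.2.2) (a x s.1 s.2.1) * b s.1 y s.2.2), c ≠ 0 := by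
    by_contra! h
    exact hne (List.sum_eq_zero h)
  obtain ⟨⟨z, α, β⟩, hs, rfl⟩ := List.mem_map.1 hc
  have hcomp := (mem_splits γ _).1 hs
  refine ⟨(⟨x, z, α⟩, ⟨z, y, β⟩), ⟨?_, ?_⟩, ?_⟩
  · intro h0
    exact hc0 (by
      change K.incl _ (a x z α) * _ = 0
      rw [show a x z α = 0 from h0, map_zero, zero_mul])
  · intro h0
    exact hc0 (by
      change _ * b z y β = 0
      rw [show b z y β = 0 from h0, mul_zero])
  · simpa [g] using hcomp

end PathSeries

variable [PathCompatible V] (K : PosetOfFields.{u, w} (Comp V))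

/-- The path algebra `P_K(E)`: the subring of `P_K((E))` of the series with finite support. -/
def pathAlgebra [Finite V] : Subring (PathSeries K) where
  carrier := {a | a.support.Finite}
  mul_mem' := PathSeries.finite_support_mul
  one_mem' := by
    refine (Set.finite_range fun x : V =>
      (⟨x, x, .nil⟩ : Σ x y : V, Quiver.Path x y)).subset ?_
    rintro ⟨x, y, γ⟩ h
    cases γ with
    | nil => exact ⟨x, rfl⟩
    | cons p e => exact absurd rfl h
  add_mem' := fun {a b} ha hb => by
    refine (Set.Finite.union ha hb).subset fun p hp => ?_
    by_contra h
    simp only [Set.mem_union, PathSeries.support, Set.mem_ofPred_eq, not_or, not_not] at h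
    exact hp (by rw [PathSeries.add_apply, h.1, h.2, add_zero])
  zero_mem' := Set.finite_empty.subset fun _ hp => hp rfl
  neg_mem' := fun {a} ha => Set.Finite.subset ha fun p hp => by
    intro h
    exact hp (by rw [PathSeries.neg_apply, h, neg_zero])

/-- The augmentation `ε : P_K((E)) → 𝓔 = ⊕_v K_[v] v`, taking the coefficients at the trivial
paths. As `E⁰` is finite, `𝓔` is the product ring `∏_v K_[v]`. -/
def augmentation : PathSeries K →+* (∀ x : V, K.fld (comp x)) where
  toFun := fun a x => a x x .nil
  map_one' := rfl
  map_mul' := fun a b => by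
    funext x
    simp [PathSeries.mul_apply, splits, K.incl_refl]
  map_zero' := rfl
  map_add' := fun _ _ => rfl

/-- The set `Σ` of the square matrices over `P_K(E)` that `ε` sends to invertible matrices. -/
def sigmaSet [Finite V] (n : ℕ) : Set (Matrix (Fin n) (Fin n) (pathAlgebra K)) :=
  {A | IsUnit (A.map fun a => augmentation K (a : PathSeries K))}

/-- For a field `F`: `P_F((E))`, with all the coefficients in `F`. -/
abbrev FieldSeries (V : Type u) [Quiver.{v} V] [Preorder V] (F : Type w) [Field F] :
    Type (max u v w) :=
  PathSeries (V := V) (PosetOfFields.const (Comp V) F)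

/-- For a field `F`: the algebra of rational series `P^rat_F(E)`, the division closure of `P_F(E)`
in `P_F((E))`. -/
def fieldRat (V : Type u) [Quiver.{v} V] [Preorder V] [PathCompatible V] [Finite V]
    (F : Type w) [Field F] : Subring (FieldSeries V F) :=
  divisionClosure (pathAlgebra (V := V) (PosetOfFields.const (Comp V) F))

end Series

section Restriction

variable {V : Type u} [Quiver.{v} V] [Preorder V]

/-- The vertices of the restriction graph `E_{I↓i}`: those `x` with `[x] ≤ i`. -/
structure Below (i : Comp V) : Type u where
  val : V
  le : comp val ≤ i

/-- The edges of the restriction graph `E_{I↓i}`: the edges of `E` between its vertices. -/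
instance (i : Comp V) : Quiver.{v} (Below i) := ⟨fun x y => (x.val ⟶ y.val)⟩

instance (i : Comp V) : Preorder (Below i) := Preorder.lift Below.val

instance (i : Comp V) [Finite V] : Finite (Below i) :=
  Finite.of_injective Below.val fun ⟨_, _⟩ ⟨_, _⟩ h => by cases h; rfl

/-- A path of `E_{I↓i}`, as a path of `E`. -/
def Below.path {i : Comp V} {x : Below i} : ∀ {y : Below i},
    Quiver.Path x y → Quiver.Path x.val y.val
  | _, .nil => .nil
  | _, .cons p e => .cons (Below.path p) e

variable [PathCompatible V]

instance (i : Comp V) : PathCompatible (Below i) :=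
  ⟨fun {y x} γ => (PathCompatible.le_of_path (Below.path γ) : x.val ≤ y.val)⟩

/-- A path of `E` that starts in `E_{I↓i}`, as a path of `E_{I↓i}`. -/
def Below.lift {i : Comp V} {x : V} (hx : comp x ≤ i) : ∀ {y : V} (γ : Quiver.Path x y),
    Quiver.Path (⟨x, hx⟩ : Below i) ⟨y, (comp_le_of_path γ).trans hx⟩
  | _, .nil => .nil
  | _, .cons p e => .cons (Below.lift hx p) e

variable (K : PosetOfFields.{u, w} (Comp V))

open Classical in
/-- A series in the paths of `E_{I↓i}` with coefficients in `K_i`, as a series in the paths of `E`,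
via `K_i ⊆ K_j` for `j ≤ i`. -/
noncomputable def extendFun (i : Comp V) (a : FieldSeries (Below i) (K.fld i)) : PathSeries K :=
  fun x y γ =>
    if hx : comp x ≤ i then
      K.incl ((comp_le_of_path γ).trans hx)
        (show K.fld i from a ⟨x, hx⟩ ⟨y, (comp_le_of_path γ).trans hx⟩ (Below.lift hx γ))
    else 0

/-- The inclusion `P_{K_i}((E_{I↓i})) ⊆ P_K((E))`. -/
noncomputable def extend (i : Comp V) : FieldSeries (Below i) (K.fld i) →+ PathSeries K where
  toFun := extendFun K i
  map_zero' := by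
    ext x y γ
    by_cases hx : comp x ≤ i
    · simp only [extendFun, dif_pos hx, PathSeries.zero_apply]
      exact map_zero (K.incl ((comp_le_of_path γ).trans hx))
    · simp only [extendFun, dif_neg hx, PathSeries.zero_apply]
  map_add' := fun a b => by
    ext x y γ
    by_cases hx : comp x ≤ i
    · simp only [extendFun, dif_pos hx, PathSeries.add_apply]
      exact map_add (K.incl ((comp_le_of_path γ).trans hx)) _ _
    · simp only [extendFun, dif_neg hx, PathSeries.add_apply, add_zero]

variable [Finite V]

/-- `P^rat_{K_i}(E_{I↓i})`, as an additive subgroup of `P_K((E))`. -/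
noncomputable def ratAt (i : Comp V) : AddSubgroup (PathSeries K) :=
  (fieldRat (Below i) (K.fld i)).toAddSubgroup.map (extend K i)

/-- The product `A B` of two additive subgroups: the finite sums of products `a b`. -/
def prodSpan {S : Type u} [Ring S] (A B : AddSubgroup S) : AddSubgroup S :=
  AddSubgroup.closure {x | ∃ a ∈ A, ∃ b ∈ B, x = a * b}

/-- The inductive definition of `P^rat_J(E) ⊆ P_K((E))` for non-empty lower subsets `J` of `I`:
`IsRat K J P` says that `P` is obtained as a value of `P^rat_J(E)`.

* If `J` is a non-empty set of minimal elements of `I`, then `P^rat_J(E)` is the sum of the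
  `P^rat_{K_i}(E_{i})` for `i ∈ J` (note `E_{i} = E_{I↓i}`).
* If `J` is a non-empty lower subset, `i` is minimal in `I \ J` and `J' = J ∪ {i}`, then
  `P^rat_{J'}(E) = P^rat_{K_i}(E_{I↓i}) + P^rat_{K_i}(E_{I↓i}) P^rat_J(E) + P^rat_J(E)`. -/
inductive IsRat : Set (Comp V) → AddSubgroup (PathSeries K) → Prop
  | base (J : Set (Comp V)) (hne : J.Nonempty) (hmin : ∀ i ∈ J, IsMin i) :
      IsRat J (⨆ i ∈ J, ratAt K i)
  | step (J : Set (Comp V)) (hne : J.Nonempty) (hlow : IsLowerSet J) (i : Comp V)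
      (hi : Minimal (fun j => j ∉ J) i) (P : AddSubgroup (PathSeries K)) (hP : IsRat J P) :
      IsRat (J ∪ {i}) (ratAt K i ⊔ prodSpan (ratAt K i) P ⊔ P)

end Restriction

end PosetFields

/-!
Every element of `P_K(E) Σ⁻¹` can be read off, in the form `w · d`, from the solution of a linear
system `w = c + w B` with `c` and `d` over `𝓔` and with the entries of `B` in the span of the
edges: the elements of this form are a subring which contains `P_K(E)`, and which is rationally
closed because the augmentation is a local homomorphism on it. The latter also shows that the image
of `P_K(E) Σ⁻¹` in `P_K((E))` is the rational closure. The map to `P_K((E))` is injective: if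
`w · d` vanishes as a series, then at each vertex `y` the coefficients of `w` at the paths ending
at `y` span a subspace that is orthogonal to `d`, contains `c`, and is carried by the edges into
the subspaces at their targets. Projecting onto these subspaces gives a matrix `E` over `𝓔` with
`c E = c`, `E B E = E B` and `E d = 0`, so that `w = w E` and `w · d = 0` hold already in
`P_K(E) Σ⁻¹`.

`P^rat_J(E)` is the set of the rational series supported at the paths that start in `J`. The point
is that the part `q a` of a rational series `a` starting in a class `i`, where `q` is the sum of
the vertices of `i`, lies in `P^rat_{K_i}(E_{I↓i}) + P^rat_{K_i}(E_{I↓i}) P^rat_{I<i}(E)`. The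
series `a` with this property form a division closed subring: `q a` determines `q a⁻¹` in terms of
the part of `a⁻¹` that starts below `i`, because `q a q` is invertible in the corner at `i`, and
paths descend.
-/

namespace PosetFields

section LocalHom

variable {R S Q : Type*} [Ring R] [Ring S] [Ring Q]

theorem isUnit_of_forall_exists_mul_eq_one {g : S →+* Q} (h : ∀ a, g a = 1 → ∃ b, b * a = 1)
    {a : S} (ha : g a = 1) : IsUnit a := by
  obtain ⟨b, hba⟩ := h a ha
  have hb : g b = 1 := by simpa [ha] using congrArg g hba
  obtain ⟨c, hcb⟩ := h b hb
  have hca : c = a := left_inv_eq_right_inv hcb hba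
  exact isUnit_iff_exists.2 ⟨b, hca ▸ hcb, hba⟩

theorem isLocalHom_of_surjective_of_map_eq_one {g : S →+* Q} (hg : Function.Surjective g)
    (h : ∀ a, g a = 1 → IsUnit a) : IsLocalHom g := by
  refine ⟨fun a ha => ?_⟩
  obtain ⟨q, haq, hqa⟩ := isUnit_iff_exists.1 ha
  obtain ⟨b, rfl⟩ := hg q
  obtain ⟨c, hc, -⟩ := isUnit_iff_exists.1 (h (a * b) (by rw [map_mul, haq]))
  obtain ⟨d, -, hd⟩ := isUnit_iff_exists.1 (h (b * a) (by rw [map_mul, hqa]))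
  exact isUnit_iff_exists_and_exists.2 ⟨⟨b * c, by rw [← mul_assoc, hc]⟩,
    ⟨d * b, by rw [mul_assoc, hd]⟩⟩

theorem ker_le_jacobson_bot (g : S →+* Q) [IsLocalHom g] :
    RingHom.ker g ≤ Ideal.jacobson ⊥ := by
  intro x hx
  refine Ideal.mem_jacobson_iff.2 fun y => ?_
  have hunit : IsUnit (g (y * x + 1)) := by
    rw [map_add, map_mul, (RingHom.mem_ker).1 hx, mul_zero, zero_add, map_one]
    exact isUnit_one
  obtain ⟨z, -, hz⟩ := isUnit_iff_exists.1 (isUnit_of_map_unit g _ hunit)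
  exact ⟨z, by rw [Ideal.mem_bot, mul_assoc, ← mul_add_one, hz, sub_self]⟩

/-- The kernel of a local homomorphism lies in the Jacobson radical, and the Jacobson radical of a
matrix ring consists of the matrices over the Jacobson radical. -/
theorem isLocalHom_mapMatrix {n : Type*} [Fintype n] [DecidableEq n] {g : S →+* Q}
    [IsLocalHom g] (hg : Function.Surjective g) :
    IsLocalHom (g.mapMatrix : Matrix n n S →+* Matrix n n Q) := by
  have hsurj : Function.Surjective (g.mapMatrix : Matrix n n S →+* Matrix n n Q) :=
    fun M => ⟨M.map (Function.surjInv hg), by ext; simp [Function.surjInv_eq]⟩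
  refine isLocalHom_of_surjective_of_map_eq_one hsurj fun A hA =>
    isUnit_of_forall_exists_mul_eq_one (fun A hA => ?_) hA
  have hmem : A - 1 ∈ Ideal.jacobson (⊥ : Ideal (Matrix n n S)) := by
    rw [← Ideal.matrix_bot]
    refine Ideal.matrix_jacobson_le ⊥ fun i j => ker_le_jacobson_bot g (RingHom.mem_ker.2 ?_)
    have hzero : g.mapMatrix (A - 1) = 0 := by rw [map_sub, hA, map_one, sub_self]
    exact congrFun₂ hzero i j
  obtain ⟨B, hB⟩ := Ideal.exists_mul_sub_mem_of_sub_one_mem_jacobson A hmem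
  exact ⟨B, sub_eq_zero.1 hB⟩

theorem isRationallyClosed_range {φ : R →+* S} {α : S →+* Q} [IsLocalHom (α.comp φ)]
    (hsurj : Function.Surjective (α.comp φ)) : IsRationallyClosed φ.range := by
  intro n A B hA hAB hBA i j
  choose A' hA' using hA
  obtain rfl : φ.mapMatrix (Matrix.of A') = A := by ext i j; exact hA' i j
  have hunit : IsUnit ((α.comp φ).mapMatrix (Matrix.of A')) :=
    (isUnit_iff_exists.2 ⟨B, hAB, hBA⟩).map (α.mapMatrix : Matrix (Fin n) (Fin n) S →+* _)
  have := isLocalHom_mapMatrix (n := Fin n) hsurj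
  obtain ⟨C, hC, -⟩ := isUnit_iff_exists.1 (isUnit_of_map_unit _ _ hunit)
  have hBC : B = φ.mapMatrix C := left_inv_eq_right_inv hBA (by rw [← map_mul, hC, map_one])
  exact ⟨C i j, by rw [hBC]; rfl⟩

theorem isRationallyClosed_of_isLocalHom {T : Subring S} {α : S →+* Q}
    [IsLocalHom (α.comp T.subtype)] (hsurj : Function.Surjective (α.comp T.subtype)) :
    IsRationallyClosed T :=
  T.range_subtype ▸ isRationallyClosed_range hsurj

end LocalHom

section Closures

variable {S : Type u} [Ring S] {R T : Subring S}

theorem IsRationallyClosed.isDivisionClosed (hT : IsRationallyClosed T) : IsDivisionClosed T := by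
  intro x hx y hxy hyx
  refine hT 1 (Matrix.of fun _ _ => x) (Matrix.of fun _ _ => y) (fun _ _ => hx) ?_ ?_ 0 0 <;>
    ext i j <;> simp [Matrix.mul_apply, Matrix.one_apply, Subsingleton.elim i j, hxy, hyx]

theorem le_divisionClosure : R ≤ divisionClosure R :=
  le_sInf fun _ hT => hT.1

theorem isDivisionClosed_divisionClosure : IsDivisionClosed (divisionClosure R) :=
  fun x hx y hxy hyx => Subring.mem_sInf.2 fun T hT => hT.2 x (Subring.mem_sInf.1 hx T hT) y hxy hyx

theorem le_rationalClosure : R ≤ rationalClosure R :=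
  le_sInf fun _ hT => hT.1

theorem rationalClosure_le (hRT : R ≤ T) (hT : IsRationallyClosed T) : rationalClosure R ≤ T :=
  sInf_le ⟨hRT, hT⟩

theorem isRationallyClosed_rationalClosure : IsRationallyClosed (rationalClosure R) :=
  fun n A B hA hAB hBA i j => Subring.mem_sInf.2 fun T hT =>
    hT.2 n A B (fun i j => Subring.mem_sInf.1 (hA i j) T hT) hAB hBA i j

end Closures

namespace UnivLoc

variable {R : Type u} [Ring R] {Sig : ∀ n : ℕ, Set (Matrix (Fin n) (Fin n) R)}

variable (Sig) in
/-- The inverse in `R Σ⁻¹` of a matrix of `Σ`. -/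
noncomputable def invMat (n : ℕ) (A : Sig n) : Matrix (Fin n) (Fin n) (UnivLoc R Sig) :=
  Matrix.of fun i j => RingQuot.mkRingHom (LocRel R Sig) (FreeAlgebra.ι ℤ (LocGen.inv n A i j))

theorem map_of_mul_invMat (n : ℕ) (A : Sig n) : A.1.map (of Sig) * invMat Sig n A = 1 := by
  ext i j
  have h := RingQuot.mkRingHom_rel (LocRel.mul_inv (Sig := Sig) n A i j)
  simp only [map_sum, map_mul, apply_ite (RingQuot.mkRingHom _), map_one, map_zero] at h
  rw [Matrix.mul_apply, Matrix.one_apply]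
  exact h

theorem invMat_mul_map_of (n : ℕ) (A : Sig n) : invMat Sig n A * A.1.map (of Sig) = 1 := by
  ext i j
  have h := RingQuot.mkRingHom_rel (LocRel.inv_mul (Sig := Sig) n A i j)
  simp only [map_sum, map_mul, apply_ite (RingQuot.mkRingHom _), map_one, map_zero] at h
  rw [Matrix.mul_apply, Matrix.one_apply]
  exact h

theorem isUnit_map_of {n : ℕ} {A : Matrix (Fin n) (Fin n) R} (hA : A ∈ Sig n) :
    IsUnit (A.map (of Sig)) :=
  isUnit_iff_exists.2 ⟨invMat Sig n ⟨A, hA⟩, map_of_mul_invMat n ⟨A, hA⟩,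
    invMat_mul_map_of n ⟨A, hA⟩⟩

theorem mem_of_generators {U : Subring (UnivLoc R Sig)} (hof : ∀ r, of Sig r ∈ U)
    (hinv : ∀ n A i j, invMat Sig n A i j ∈ U) (t : UnivLoc R Sig) : t ∈ U := by
  obtain ⟨x, rfl⟩ := RingQuot.mkRingHom_surjective _ t
  induction x using FreeAlgebra.induction with
  | grade0 n =>
    rw [eq_intCast, map_intCast]
    exact intCast_mem U n
  | grade1 x =>
    cases x with
    | coeff r => exact hof r
    | inv n A i j => exact hinv n A i j
  | mul a b ha hb => rw [map_mul]; exact mul_mem ha hb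
  | add a b ha hb => rw [map_add]; exact add_mem ha hb

theorem map_mem_of_isRationallyClosed {S : Type v} [Ring S] {T : Subring S}
    (hT : IsRationallyClosed T) {φ : UnivLoc R Sig →+* S} (hof : ∀ r, φ (of Sig r) ∈ T)
    (t : UnivLoc R Sig) : φ t ∈ T := by
  refine mem_of_generators (U := T.comap φ) hof (fun n A => ?_) t
  have hmul : φ.mapMatrix (A.1.map (of Sig)) * φ.mapMatrix (invMat Sig n A) = 1 := by
    rw [← map_mul, map_of_mul_invMat, map_one]
  have hmul' : φ.mapMatrix (invMat Sig n A) * φ.mapMatrix (A.1.map (of Sig)) = 1 := by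
    rw [← map_mul, invMat_mul_map_of, map_one]
  exact hT n _ _ (fun i j => hof (A.1 i j)) hmul hmul'

theorem ringHom_ext {T : Type*} [Ring T] {ψ χ : UnivLoc R Sig →+* T}
    (h : ∀ r, ψ (of Sig r) = χ (of Sig r)) : ψ = χ := by
  refine RingHom.ext fun t => mem_of_generators (U := ψ.eqLocus χ) h (fun n A i j => ?_) t
  have hof : ψ.mapMatrix (A.1.map (of Sig)) = χ.mapMatrix (A.1.map (of Sig)) := by
    ext i j
    exact h _
  have hψ : ψ.mapMatrix (invMat Sig n A) * ψ.mapMatrix (A.1.map (of Sig)) = 1 := by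
    rw [← map_mul, invMat_mul_map_of, map_one]
  have hχ : ψ.mapMatrix (A.1.map (of Sig)) * χ.mapMatrix (invMat Sig n A) = 1 := by
    rw [hof, ← map_mul, map_of_mul_invMat, map_one]
  have heq := left_inv_eq_right_inv hψ hχ
  exact congrFun₂ heq i j

section Lift

variable {T : Type*} [Ring T] (g : R →+* T) (hg : ∀ n, ∀ A ∈ Sig n, IsUnit (A.map g))

/-- The values of the homomorphism `lift` on the generators of `R Σ⁻¹`. -/
noncomputable def liftGen : LocGen R Sig → T
  | .coeff r => g r
  | .inv n A i j => (↑(hg n A.1 A.2).unit⁻¹ : Matrix (Fin n) (Fin n) T) i j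

theorem lift_liftGen_eq_of_rel {x y : FreeAlgebra ℤ (LocGen R Sig)} (hxy : LocRel R Sig x y) :
    FreeAlgebra.lift ℤ (liftGen g hg) x = FreeAlgebra.lift ℤ (liftGen g hg) y := by
  induction hxy with
  | one => simp [liftGen]
  | add r s => simp [liftGen]
  | mul r s => simp [liftGen]
  | mul_inv n A i j =>
    have h := congrFun₂ (hg n A.1 A.2).mul_val_inv i j
    rw [Matrix.mul_apply, Matrix.one_apply] at h
    simp only [map_sum, map_mul, FreeAlgebra.lift_ι_apply, apply_ite (FreeAlgebra.lift ℤ _),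
      map_one, map_zero]
    exact h
  | inv_mul n A i j =>
    have h := congrFun₂ (hg n A.1 A.2).val_inv_mul i j
    rw [Matrix.mul_apply, Matrix.one_apply] at h
    simp only [map_sum, map_mul, FreeAlgebra.lift_ι_apply, apply_ite (FreeAlgebra.lift ℤ _),
      map_one, map_zero]
    exact h

/-- The homomorphism on `R Σ⁻¹` given by the universal property. -/
noncomputable def lift : UnivLoc R Sig →+* T :=
  RingQuot.lift ⟨(FreeAlgebra.lift ℤ (liftGen g hg)).toRingHom,
    fun _ _ hxy => lift_liftGen_eq_of_rel g hg hxy⟩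

theorem lift_of (r : R) : lift g hg (of Sig r) = g r :=
  (RingQuot.lift_mkRingHom_apply _ _ _).trans (by simp [liftGen])

end Lift

end UnivLoc

section LinearSystem

open Matrix

variable {T : Type*} [Ring T] {p : Type*} [Fintype p] [DecidableEq p]

theorem eq_of_eq_add_vecMul {B : Matrix p p T} (hB : IsUnit (1 - B)) {c w w' : p → T}
    (hw : w = c + w ᵥ* B) (hw' : w' = c + w' ᵥ* B) : w = w' := by
  obtain ⟨C, hC, -⟩ := isUnit_iff_exists.1 hB
  have solve {z : p → T} (hz : z = c + z ᵥ* B) : z = c ᵥ* C := by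
    have hzc : z ᵥ* (1 - B) = c := by rw [vecMul_sub, vecMul_one, sub_eq_iff_eq_add, ← hz]
    rw [← hzc, vecMul_vecMul, hC, vecMul_one]
  rw [solve hw, solve hw']

theorem exists_eq_add_vecMul {B : Matrix p p T} (hB : IsUnit (1 - B)) (c : p → T) :
    ∃ w : p → T, w = c + w ᵥ* B := by
  obtain ⟨C, -, hC⟩ := isUnit_iff_exists.1 hB
  have hsol : (c ᵥ* C) ᵥ* (1 - B) = c := by rw [vecMul_vecMul, hC, vecMul_one]
  exact ⟨c ᵥ* C, by rwa [vecMul_sub, vecMul_one, sub_eq_iff_eq_add] at hsol⟩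

theorem dotProduct_eq_zero_of_invariant {B E : Matrix p p T} (hB : IsUnit (1 - B))
    (hEB : IsUnit (1 - E * B)) {c d w : p → T} (hw : w = c + w ᵥ* B) (hcE : c ᵥ* E = c)
    (hEBE : E * B * E = E * B) (hEd : E *ᵥ d = 0) : w ⬝ᵥ d = 0 := by
  obtain ⟨y, hy⟩ := exists_eq_add_vecMul hEB c
  have hyE : y ᵥ* E = y := by
    conv_lhs => rw [hy]
    rw [add_vecMul, hcE, vecMul_vecMul, hEBE, ← hy]
  have hyw : y = w := by
    refine eq_of_eq_add_vecMul hB ?_ hw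
    rwa [← vecMul_vecMul, hyE] at hy
  rw [← hyw, ← hyE, ← dotProduct_mulVec, hEd, dotProduct_zero]

end LinearSystem

section Realizable

open Matrix

variable {T Q : Type*} [Ring T] [Ring Q]

/-- An element of `T` is *realizable* if it is read off, with coefficients `d` in `Q`, from a
solution `w` of a linear system `w = c + w B` with constant terms `c` in `Q` and with a matrix `B`
over `W`. This is Cohn's presentation of rational elements by linear systems, in the form used
for weighted automata; `g` embeds the coefficients. -/
def IsRealizable (g : Q →+* T) (W : AddSubgroup T) (t : T) : Prop :=
  ∃ (p : Type) (_ : Fintype p) (B : Matrix p p T) (c d : p → Q) (w : p → T),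
    (∀ i j, B i j ∈ W) ∧ w = g ∘ c + w ᵥ* B ∧ t = w ⬝ᵥ (g ∘ d)

variable {g : Q →+* T} {W : AddSubgroup T}

theorem isRealizable_map (q : Q) : IsRealizable g W (g q) :=
  ⟨Unit, inferInstance, 0, fun _ => 1, fun _ => q, 1, fun _ _ => zero_mem W,
    by ext; simp, by simp [dotProduct]⟩

theorem isRealizable_of_mem {t : T} (ht : t ∈ W) : IsRealizable g W t := by
  refine ⟨Fin 2, inferInstance, !![0, t; 0, 0], ![1, 0], ![0, 1], ![1, t], ?_, ?_, ?_⟩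
  · intro i j
    fin_cases i <;> fin_cases j <;> simp [ht]
  · ext i
    fin_cases i <;> simp
  · simp [dotProduct]

theorem IsRealizable.neg {s : T} (hs : IsRealizable g W s) : IsRealizable g W (-s) := by
  obtain ⟨p, _, B, c, d, w, hB, hw, rfl⟩ := hs
  refine ⟨p, _, B, c, -d, w, hB, hw, ?_⟩
  rw [← dotProduct_neg]
  congr 1
  ext; simp

theorem IsRealizable.add {s t : T} (hs : IsRealizable g W s) (ht : IsRealizable g W t) :
    IsRealizable g W (s + t) := by
  obtain ⟨p, _, B, c, d, w, hB, hw, rfl⟩ := hs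
  obtain ⟨p', _, B', c', d', w', hB', hw', rfl⟩ := ht
  refine ⟨p ⊕ p', inferInstance, fromBlocks B 0 0 B', Sum.elim c c', Sum.elim d d',
    Sum.elim w w', ?_, ?_, ?_⟩
  · rintro (i | i) (j | j)
    exacts [hB i j, zero_mem W, zero_mem W, hB' i j]
  · rw [vecMul_fromBlocks, Sum.comp_elim]
    simp only [Sum.elim_comp_inl, Sum.elim_comp_inr, vecMul_zero, add_zero, zero_add]
    rw [← Sum.elim_add_add, ← hw, ← hw']
  · rw [Sum.comp_elim, sumElim_dotProduct_sumElim]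

theorem mul_vecMulVec_map_mem (hW : ∀ q, ∀ b ∈ W, b * g q ∈ W) {p p' : Type*} [Fintype p]
    {B : Matrix p p T} (hB : ∀ i j, B i j ∈ W) (d : p → Q) (c : p' → Q) (i : p) (j : p') :
    (B * vecMulVec (g ∘ d) (g ∘ c)) i j ∈ W := by
  simp only [mul_apply, vecMulVec_apply, Function.comp_apply, ← map_mul]
  exact sum_mem fun k _ => hW _ _ (hB i k)

theorem IsRealizable.mul (hW : ∀ q, ∀ b ∈ W, b * g q ∈ W) {s t : T} (hs : IsRealizable g W s)
    (ht : IsRealizable g W t) : IsRealizable g W (s * t) := by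
  obtain ⟨p, _, B, c, d, w, hB, hw, hs⟩ := hs
  obtain ⟨p', _, B', c', d', w', hB', hw', rfl⟩ := ht
  have hs' : s = g (c ⬝ᵥ d) + (w ᵥ* B) ⬝ᵥ (g ∘ d) := by
    rw [RingHom.map_dotProduct, ← add_dotProduct, ← hw, hs]
  refine ⟨p ⊕ p', inferInstance, fromBlocks B (B * vecMulVec (g ∘ d) (g ∘ c')) 0 B',
    Sum.elim c ((c ⬝ᵥ d) • c'), Sum.elim 0 d', Sum.elim w (s • w'), ?_, ?_, ?_⟩
  · rintro (i | i) (j | j)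
    exacts [hB i j, mul_vecMulVec_map_mem hW hB d c' i j, zero_mem W, hB' i j]
  · have hc' : g ∘ ((c ⬝ᵥ d) • c') = g (c ⬝ᵥ d) • (g ∘ c') := by ext; simp
    have hsw' : s • w' =
        g (c ⬝ᵥ d) • (g ∘ c') + (((w ᵥ* B) ⬝ᵥ (g ∘ d)) • (g ∘ c') + (s • w') ᵥ* B') := by
      rw [smul_vecMul, ← add_assoc, ← add_smul, ← hs', ← smul_add, ← hw']
    rw [vecMul_fromBlocks, Sum.comp_elim, hc', ← vecMul_vecMul, vecMul_vecMulVec]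
    simp only [Sum.elim_comp_inl, Sum.elim_comp_inr, vecMul_zero, add_zero]
    rw [← Sum.elim_add_add, ← hw, ← hsw']
  · have hzero : g ∘ (0 : p → Q) = 0 := by ext; simp
    rw [Sum.comp_elim, sumElim_dotProduct_sumElim, hzero, dotProduct_zero, zero_add,
      smul_dotProduct, smul_eq_mul]

/-- The subring of the realizable elements. -/
def realizable (g : Q →+* T) (W : AddSubgroup T) (hW : ∀ q, ∀ b ∈ W, b * g q ∈ W) :
    Subring T where
  carrier := {t | IsRealizable g W t}
  mul_mem' := IsRealizable.mul hW
  one_mem' := map_one g ▸ isRealizable_map 1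
  add_mem' := IsRealizable.add
  zero_mem' := map_zero g ▸ isRealizable_map 0
  neg_mem' := IsRealizable.neg

/-- The subgroup `W` *complements* the coefficients `g : Q →+* T` with respect to the retraction
`α` of `g`: `α` kills `W`, and matrices over `W` are quasi-invertible. Here `T` will be the
universal localization of a path algebra and `W` the image of the span of the edges. -/
structure IsRadicalComplement (g : Q →+* T) (α : T →+* Q) (W : AddSubgroup T) : Prop where
  map_map : ∀ q, α (g q) = q
  map_eq_zero : ∀ b ∈ W, α b = 0
  mul_map_mem : ∀ q, ∀ b ∈ W, b * g q ∈ W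
  isUnit_one_sub : ∀ (p : Type) [Fintype p] [DecidableEq p] (B : Matrix p p T),
    (∀ i j, B i j ∈ W) → IsUnit (1 - B)

namespace IsRadicalComplement

variable {α : T →+* Q}

theorem comp_eq (h : IsRadicalComplement g α W) {p : Type*} [Fintype p] {B : Matrix p p T}
    (hB : ∀ i j, B i j ∈ W) {c : p → Q} {w : p → T} (hw : w = g ∘ c + w ᵥ* B) : α ∘ w = c := by
  ext j
  have hαB : α ((w ᵥ* B) j) = 0 := by
    simp only [vecMul, dotProduct, map_sum, map_mul, h.map_eq_zero _ (hB _ j), mul_zero,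
      Finset.sum_const_zero]
  rw [Function.comp_apply, hw, Pi.add_apply, map_add, hαB, add_zero, Function.comp_apply,
    h.map_map]

/-- If `w` solves `w = c + w B` and `c ⬝ d = 0`, the solution of `z = c + z (B + B d c)` is
`(1 + z d) w`, so that `1 + z d` is a left inverse of `1 - w d`. -/
theorem exists_mul_one_sub_eq_one (h : IsRadicalComplement g α W) {s : T}
    (hs : IsRealizable g W s) (hαs : α s = 0) :
    ∃ b, IsRealizable g W b ∧ (1 + b) * (1 - s) = 1 := by
  classical
  obtain ⟨p, _, B, c, d, w, hB, hw, rfl⟩ := hs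
  have hcd : (g ∘ c) ⬝ᵥ (g ∘ d) = 0 := by
    have hαgd : α ∘ g ∘ d = d := by ext; simp [h.map_map]
    rw [RingHom.map_dotProduct, h.comp_eq hB hw, hαgd] at hαs
    rw [← RingHom.map_dotProduct, hαs, map_zero]
  have hN : ∀ i j, (B + B * vecMulVec (g ∘ d) (g ∘ c)) i j ∈ W := fun i j =>
    add_mem (hB i j) (mul_vecMulVec_map_mem h.mul_map_mem hB d c i j)
  obtain ⟨z, hz⟩ := exists_eq_add_vecMul (h.isUnit_one_sub p _ hN) (g ∘ c)
  set b := z ⬝ᵥ (g ∘ d) with hb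
  have hzB : z = (g ∘ c + z ᵥ* B) + ((z ᵥ* B) ⬝ᵥ (g ∘ d)) • (g ∘ c) := by
    rwa [vecMul_add, ← vecMul_vecMul, vecMul_vecMulVec, ← add_assoc] at hz
  have hbB : b = (z ᵥ* B) ⬝ᵥ (g ∘ d) :=
    calc b = (g ∘ c + z ᵥ* B + ((z ᵥ* B) ⬝ᵥ (g ∘ d)) • (g ∘ c)) ⬝ᵥ (g ∘ d) := by rw [← hzB]
      _ = (z ᵥ* B) ⬝ᵥ (g ∘ d) := by
        rw [add_dotProduct, add_dotProduct, smul_dotProduct, hcd, smul_zero, add_zero, zero_add]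
  have hzw : z = (1 + b) • w := by
    refine eq_of_eq_add_vecMul (h.isUnit_one_sub p B hB) (c := (1 + b) • (g ∘ c)) ?_ ?_
    · rw [add_smul, one_smul, add_right_comm, hbB, ← hzB]
    · rw [smul_vecMul, ← smul_add, ← hw]
  have hbs : b = (1 + b) * (w ⬝ᵥ (g ∘ d)) := by
    rw [← smul_eq_mul, ← smul_dotProduct, ← hzw]
  exact ⟨b, ⟨p, _, _, c, d, z, hN, hz, hb⟩, by rw [mul_sub, ← hbs, mul_one, add_sub_cancel_right]⟩

theorem surjective_comp_subtype_realizable (h : IsRadicalComplement g α W) :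
    Function.Surjective (α.comp (realizable g W h.mul_map_mem).subtype) :=
  fun q => ⟨⟨g q, isRealizable_map q⟩, h.map_map q⟩

theorem isLocalHom_comp_subtype_realizable (h : IsRadicalComplement g α W) :
    IsLocalHom (α.comp (realizable g W h.mul_map_mem).subtype) := by
  refine isLocalHom_of_surjective_of_map_eq_one h.surjective_comp_subtype_realizable
    fun a ha => isUnit_of_forall_exists_mul_eq_one (fun a ha => ?_) ha
  have hzero : α (1 - a : T) = 0 := by
    rw [map_sub, map_one, sub_eq_zero]
    exact ha.symm
  obtain ⟨b, hb, hba⟩ := h.exists_mul_one_sub_eq_one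
    (sub_mem (one_mem (realizable g W h.mul_map_mem)) a.2) hzero
  exact ⟨1 + ⟨b, hb⟩, Subtype.ext (by simpa using hba)⟩

theorem isRationallyClosed_realizable {T : Type u} [Ring T] {g : Q →+* T} {α : T →+* Q}
    {W : AddSubgroup T} (h : IsRadicalComplement g α W) :
    IsRationallyClosed (realizable g W h.mul_map_mem) :=
  have := h.isLocalHom_comp_subtype_realizable
  isRationallyClosed_of_isLocalHom h.surjective_comp_subtype_realizable

end IsRadicalComplement

end Realizable

section SeriesBasics

variable {V : Type u} [Quiver.{v} V] [Preorder V] {K : PosetOfFields.{u, w} (Comp V)}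

namespace PathSeries

@[simp] theorem sub_apply (a b : PathSeries K) (x y : V) (γ : Quiver.Path x y) :
    (a - b) x y γ = a x y γ - b x y γ := rfl

theorem sum_apply {ι : Type*} (s : Finset ι) (a : ι → PathSeries K) (x y : V)
    (γ : Quiver.Path x y) : (∑ i ∈ s, a i) x y γ = ∑ i ∈ s, a i x y γ :=
  map_sum (⟨⟨fun b : PathSeries K => b x y γ, rfl⟩, fun _ _ => rfl⟩ :
    PathSeries K →+ K.fld (comp y)) a s

/-- The coefficients of the series `∑_v k_v v`. -/
def diagCoeff (k : ∀ x : V, K.fld (comp x)) : ∀ x y : V, Quiver.Path x y → K.fld (comp y)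
  | _, _, .nil => k _
  | _, _, .cons _ _ => 0

/-- The series `∑_v k_v v`. -/
def diagSeries (k : ∀ x : V, K.fld (comp x)) : PathSeries K :=
  diagCoeff k

variable [PathCompatible V]

theorem mul_apply_nil (a b : PathSeries K) (x : V) :
    (a * b) x x .nil = a x x .nil * b x x .nil :=
  congrFun (map_mul (augmentation K) a b) x

theorem mul_diagSeries_apply (a : PathSeries K) (k : ∀ x : V, K.fld (comp x)) (x y : V)
    (γ : Quiver.Path x y) : (a * diagSeries k) x y γ = a x y γ * k y := by
  have h := sum_splits_right γ (fun z α β => K.incl (comp_le_of_path β) (a x z α) *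
    diagSeries k z y β) (fun z t α β e => mul_zero _)
  rw [mul_apply, h, K.incl_refl]
  rfl

variable (K) in
/-- The embedding `𝓔 → P_K((E))`, sending `k` to `∑_v k_v v`. -/
def diag : (∀ x : V, K.fld (comp x)) →+* PathSeries K where
  toFun := diagSeries
  map_one' := by
    ext x y γ
    cases γ <;> rfl
  map_mul' k l := by
    ext x y γ
    rw [mul_diagSeries_apply]
    cases γ with
    | nil => rfl
    | cons p e => exact (zero_mul _).symm
  map_zero' := by
    ext x y γ
    cases γ <;> rfl
  map_add' k l := by
    ext x y γ
    cases γ with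
    | nil => rfl
    | cons p e => exact (add_zero _).symm

@[simp] theorem diag_nil (k : ∀ x : V, K.fld (comp x)) (x : V) : diag K k x x .nil = k x := rfl

@[simp] theorem diag_cons (k : ∀ x : V, K.fld (comp x)) {x y z : V} (p : Quiver.Path x y)
    (e : y ⟶ z) : diag K k x z (p.cons e) = 0 := rfl

theorem mul_diag_apply (a : PathSeries K) (k : ∀ x : V, K.fld (comp x)) (x y : V)
    (γ : Quiver.Path x y) : (a * diag K k) x y γ = a x y γ * k y :=
  mul_diagSeries_apply a k x y γ

theorem diag_mul_apply (k : ∀ x : V, K.fld (comp x)) (a : PathSeries K) (x y : V)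
    (γ : Quiver.Path x y) :
    (diag K k * a) x y γ = K.incl (comp_le_of_path γ) (k x) * a x y γ := by
  have h := sum_splits_left γ (fun z α β => K.incl (comp_le_of_path β)
    (diag K k x z α) * a z y β)
    (fun z t α e β => by rw [diag_cons, map_zero, zero_mul])
  rw [mul_apply, h, diag_nil]

theorem augmentation_diag (k : ∀ x : V, K.fld (comp x)) : augmentation K (diag K k) = k := rfl

theorem augmentation_surjective : Function.Surjective (augmentation K) :=
  fun k => ⟨diag K k, augmentation_diag k⟩

end PathSeries

end SeriesBasics

section Inverses

namespace PathSeries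

variable {V : Type u} [Quiver.{v} V] [Preorder V] {K : PosetOfFields.{u, w} (Comp V)}

/-- The series `a` lies in the `n`-th power of the ideal of the paths of positive length. -/
def VanishesBelow (n : ℕ) (a : PathSeries K) : Prop :=
  ∀ (x y : V) (γ : Quiver.Path x y), γ.length < n → a x y γ = 0

theorem vanishesBelow_zero (a : PathSeries K) : VanishesBelow 0 a :=
  fun _ _ _ h => absurd h (Nat.not_lt_zero _)

theorem eq_of_forall_vanishesBelow_sub {a b : PathSeries K} (h : ∀ n, VanishesBelow n (a - b)) :
    a = b := by
  ext x y γ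
  exact sub_eq_zero.1 (h (γ.length + 1) x y γ (Nat.lt_succ_self _))

theorem VanishesBelow.sub {n : ℕ} {a b : PathSeries K} (ha : VanishesBelow n a)
    (hb : VanishesBelow n b) : VanishesBelow n (a - b) := by
  intro x y γ hγ
  rw [sub_apply, ha _ _ _ hγ, hb _ _ _ hγ, sub_zero]

variable [PathCompatible V]

theorem VanishesBelow.mul {m n : ℕ} {a b : PathSeries K} (ha : VanishesBelow m a)
    (hb : VanishesBelow n b) : VanishesBelow (m + n) (a * b) := by
  intro x y γ hγ
  rw [mul_apply]
  refine List.sum_eq_zero fun c hc => ?_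
  obtain ⟨s, hs, rfl⟩ := List.mem_map.1 hc
  have hlen := congrArg Quiver.Path.length ((mem_splits γ s).1 hs)
  rw [Quiver.Path.length_comp] at hlen
  by_cases h : s.2.1.length < m
  · rw [ha _ _ _ h, map_zero, zero_mul]
  · rw [hb _ _ _ (by omega), mul_zero]

theorem VanishesBelow.pow {a : PathSeries K} (ha : VanishesBelow 1 a) :
    ∀ n : ℕ, VanishesBelow n (a ^ n)
  | 0 => vanishesBelow_zero _
  | n + 1 => by rw [pow_succ]; exact (ha.pow n).mul ha

theorem vanishesBelow_one_iff {a : PathSeries K} : VanishesBelow 1 a ↔ augmentation K a = 0 := by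
  refine ⟨fun h => funext fun x => h x x .nil Nat.zero_lt_one, fun h x y γ hγ => ?_⟩
  cases γ with
  | nil => exact congrFun h x
  | cons p e => simp at hγ

/-- The geometric series `∑ bⁿ`, for `b` of augmentation zero: `bⁿ` has no coefficients at the
paths of length less than `n`, so the sum is finite at every path. -/
def geom (b : PathSeries K) : PathSeries K :=
  fun x y γ => (∑ k ∈ Finset.range (γ.length + 1), b ^ k) x y γ

theorem vanishesBelow_geom_sub {b : PathSeries K} (hb : VanishesBelow 1 b) (n : ℕ) :
    VanishesBelow n (geom b - ∑ k ∈ Finset.range n, b ^ k) := by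
  intro x y γ hγ
  rw [sub_apply, sub_eq_zero, geom]
  obtain ⟨m, rfl⟩ := Nat.exists_eq_add_of_le (show γ.length + 1 ≤ n from hγ)
  rw [Finset.sum_range_add _ (γ.length + 1) m, add_apply, sum_apply (Finset.range m),
    Finset.sum_eq_zero (s := Finset.range m), add_zero]
  exact fun k _ => hb.pow _ _ _ _ (by omega)

theorem geom_mul_one_sub {b : PathSeries K} (hb : VanishesBelow 1 b) : geom b * (1 - b) = 1 := by
  refine eq_of_forall_vanishesBelow_sub fun n => ?_
  have h : geom b * (1 - b) - 1 =
      (geom b - ∑ k ∈ Finset.range n, b ^ k) * (1 - b) - b ^ n := by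
    rw [sub_mul, geom_sum_mul_neg]
    abel
  rw [h]
  exact ((vanishesBelow_geom_sub hb n).mul (vanishesBelow_zero (1 - b))).sub (hb.pow n)

instance isLocalHom_augmentation : IsLocalHom (augmentation K) := by
  refine isLocalHom_of_surjective_of_map_eq_one augmentation_surjective fun a ha =>
    isUnit_of_forall_exists_mul_eq_one (fun a ha => ⟨geom (1 - a), ?_⟩) ha
  have hvanish : VanishesBelow 1 (1 - a) := by
    rw [vanishesBelow_one_iff, map_sub, map_one, ha, sub_self]
  simpa only [sub_sub_cancel] using geom_mul_one_sub hvanish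

theorem isRationallyClosed_of_isDivisionClosed {T : Subring (PathSeries K)}
    (hT : IsDivisionClosed T) (hdiag : ∀ k, diag K k ∈ T) : IsRationallyClosed T := by
  have : IsLocalHom ((augmentation K).comp T.subtype) := by
    refine ⟨fun a ha => ?_⟩
    obtain ⟨b, hab, hba⟩ := isUnit_iff_exists.1 (isUnit_of_map_unit (augmentation K) a.1 ha)
    exact isUnit_iff_exists.2 ⟨⟨b, hT a a.2 b hab hba⟩, Subtype.ext hab, Subtype.ext hba⟩
  exact isRationallyClosed_of_isLocalHom (α := augmentation K)
    fun k => ⟨⟨diag K k, hdiag k⟩, augmentation_diag k⟩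

end PathSeries

end Inverses

theorem exists_eq_cons_nil_of_length_eq_one {V : Type u} [Quiver.{v} V] {x y : V}
    (γ : Quiver.Path x y) (h : γ.length = 1) : ∃ e : x ⟶ y, γ = .cons .nil e := by
  cases γ with
  | nil => simp at h
  | cons p e =>
    cases p with
    | nil => exact ⟨e, rfl⟩
    | cons p f => simp at h

section Monomials

namespace PathSeries

variable {V : Type u} [Quiver.{v} V] [Preorder V] {K : PosetOfFields.{u, w} (Comp V)}

open Classical in
/-- The path `p`, as a series. -/
noncomputable def single (p : Σ x y : V, Quiver.Path x y) : PathSeries K :=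
  fun x y γ => if (⟨x, y, γ⟩ : Σ x y : V, Quiver.Path x y) = p then 1 else 0

open Classical in
theorem single_apply (p : Σ x y : V, Quiver.Path x y) (x y : V) (γ : Quiver.Path x y) :
    single (K := K) p x y γ = if (⟨x, y, γ⟩ : Σ x y : V, Quiver.Path x y) = p then 1 else 0 := rfl

theorem single_apply_of_length_ne (p : Σ x y : V, Quiver.Path x y) {x y : V} {γ : Quiver.Path x y}
    (h : γ.length ≠ p.2.2.length) : single (K := K) p x y γ = 0 := by
  rw [single_apply, if_neg]
  rintro rfl
  exact h rfl

variable (K) in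
/-- The series supported at the paths of length one. -/
def edgeSeries : AddSubgroup (PathSeries K) where
  carrier := {a | ∀ (x y : V) (γ : Quiver.Path x y), γ.length ≠ 1 → a x y γ = 0}
  add_mem' := fun {a b} ha hb x y γ h => by
    rw [add_apply, ha x y γ h, hb x y γ h, add_zero]
  zero_mem' := fun _ _ _ _ => rfl
  neg_mem' := fun {a} ha x y γ h => by rw [neg_apply, ha x y γ h, neg_zero]

theorem single_edge_mem_edgeSeries {x y : V} (e : x ⟶ y) :
    single ⟨x, y, .cons .nil e⟩ ∈ edgeSeries K :=
  fun _ _ _ h => single_apply_of_length_ne _ h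

theorem apply_nil_of_mem_edgeSeries {a : PathSeries K} (ha : a ∈ edgeSeries K) (x : V) :
    a x x .nil = 0 :=
  ha x x .nil (by simp)

variable [PathCompatible V]

theorem augmentation_eq_zero_of_mem_edgeSeries {a : PathSeries K} (ha : a ∈ edgeSeries K) :
    augmentation K a = 0 :=
  funext (apply_nil_of_mem_edgeSeries ha)

theorem mul_diag_mem_edgeSeries {a : PathSeries K} (ha : a ∈ edgeSeries K)
    (k : ∀ x : V, K.fld (comp x)) : a * diag K k ∈ edgeSeries K :=
  fun x y γ h => by rw [mul_diag_apply, ha x y γ h, zero_mul]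

theorem mul_edge_apply (a : PathSeries K) {b : PathSeries K} (hb : b ∈ edgeSeries K) {x y z : V}
    (p : Quiver.Path x y) (e : y ⟶ z) :
    (a * b) x z (p.cons e) =
      K.incl (comp_le_of_path (Quiver.Path.nil.cons e)) (a x y p) * b y z (.cons .nil e) := by
  have h := sum_splits_right p (fun t α β => K.incl (comp_le_of_path (β.cons e)) (a x t α) *
    b t z (β.cons e)) fun t s α β f => by rw [hb _ _ _ (by simp), mul_zero]
  simp only [mul_apply, splits, List.map_cons, List.sum_cons, List.map_map, Function.comp_def]
  rw [apply_nil_of_mem_edgeSeries hb, mul_zero, zero_add, h]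

theorem single_nil [DecidableEq V] (x : V) :
    single (K := K) ⟨x, x, .nil⟩ = diag K (Pi.single x 1) := by
  ext x' y γ
  cases γ with
  | nil =>
    rw [single_apply, diag_nil]
    by_cases h : x' = x
    · subst h; simp
    · rw [Pi.single_eq_of_ne h, if_neg]
      rintro ⟨⟩
      exact h rfl
  | cons p e =>
    rw [diag_cons, single_apply_of_length_ne]
    simp

theorem single_cons {x y z : V} (p : Quiver.Path x y) (e : y ⟶ z) :
    single (K := K) ⟨x, z, p.cons e⟩ = single ⟨x, y, p⟩ * single ⟨y, z, .cons .nil e⟩ := by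
  ext x' z' γ
  cases γ with
  | nil =>
    rw [mul_apply_nil, single_apply_of_length_ne _ (by simp),
      apply_nil_of_mem_edgeSeries (single_edge_mem_edgeSeries e), mul_zero]
  | cons q f =>
    rw [mul_edge_apply _ (single_edge_mem_edgeSeries e)]
    simp only [single_apply]
    by_cases h : (⟨x', z', q.cons f⟩ : Σ x y : V, Quiver.Path x y) = ⟨x, z, p.cons e⟩
    · cases h
      simp
    · rw [if_neg h]
      split_ifs with hq hf
      · cases hq
        cases hf
        exact absurd rfl h
      all_goals simp only [map_zero, mul_zero, zero_mul]

theorem eq_sum_single [DecidableEq V] {a : PathSeries K} {s : Finset (Σ x y : V, Quiver.Path x y)}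
    (hs : a.support ⊆ s) :
    a = ∑ p ∈ s, single p * diag K (Pi.single p.2.1 (a p.1 p.2.1 p.2.2)) := by
  ext x y γ
  simp only [sum_apply, mul_diag_apply, single_apply]
  by_cases h : (⟨x, y, γ⟩ : Σ x y : V, Quiver.Path x y) ∈ s
  · rw [Finset.sum_eq_single_of_mem _ h]
    · simp
    · intro p _ hp
      rw [if_neg (Ne.symm hp), zero_mul]
  · rw [Finset.sum_eq_zero]
    · by_contra ha
      exact h (hs ha)
    · intro p hp
      rw [if_neg, zero_mul]
      rintro rfl
      exact h hp

end PathSeries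

end Monomials

section PathAlgebra

open PathSeries

variable {V : Type u} [Quiver.{v} V] [Finite V] [Preorder V] [PathCompatible V]
  {K : PosetOfFields.{u, w} (Comp V)}

theorem diag_mem_pathAlgebra (k : ∀ x : V, K.fld (comp x)) : diag K k ∈ pathAlgebra K := by
  refine (Set.finite_range fun x : V =>
    (⟨x, x, .nil⟩ : Σ x y : V, Quiver.Path x y)).subset ?_
  rintro ⟨x, y, γ⟩ h
  cases γ with
  | nil => exact ⟨x, rfl⟩
  | cons p e => exact absurd rfl h

theorem single_mem_pathAlgebra (p : Σ x y : V, Quiver.Path x y) : single p ∈ pathAlgebra K := by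
  refine (Set.finite_singleton p).subset fun q hq => ?_
  by_contra h
  exact hq (if_neg h)

theorem pathAlgebra_le {U : Subring (PathSeries K)} (hdiag : ∀ k, diag K k ∈ U)
    (hedge : ∀ (x y : V) (e : x ⟶ y), single ⟨x, y, .cons .nil e⟩ ∈ U) : pathAlgebra K ≤ U := by
  classical
  have hsingle (x y : V) (γ : Quiver.Path x y) : single ⟨x, y, γ⟩ ∈ U := by
    induction γ with
    | nil => exact single_nil (K := K) x ▸ hdiag _
    | cons p e ih => exact single_cons (K := K) p e ▸ mul_mem ih (hedge _ _ e)
  intro a ha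
  have hfin : a.support.Finite := ha
  rw [eq_sum_single (a := a) (s := hfin.toFinset) hfin.coe_toFinset.superset]
  exact sum_mem fun p _ => mul_mem (hsingle _ _ _) (hdiag _)

variable (K) in
/-- The embedding `𝓔 → P_K(E)`. -/
def diagAlg : (∀ x : V, K.fld (comp x)) →+* pathAlgebra K :=
  (diag K).codRestrict (pathAlgebra K) diag_mem_pathAlgebra

theorem mem_of_pathAlgebra_generators {U : Subring (pathAlgebra K)}
    (hdiag : ∀ k, diagAlg K k ∈ U)
    (hedge : ∀ a : pathAlgebra K, (a : PathSeries K) ∈ edgeSeries K → a ∈ U)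
    (a : pathAlgebra K) : a ∈ U := by
  have hle : pathAlgebra K ≤ U.map (pathAlgebra K).subtype :=
    pathAlgebra_le (fun k => ⟨_, hdiag k, rfl⟩) fun x y e =>
      ⟨⟨_, single_mem_pathAlgebra _⟩, hedge _ (single_edge_mem_edgeSeries e), rfl⟩
  obtain ⟨b, hb, hba⟩ := hle a.2
  rwa [← Subtype.ext hba]

end PathAlgebra

section Localization

open PathSeries Matrix

variable {V : Type u} [Quiver.{v} V] [Finite V] [Preorder V] [PathCompatible V]
  (K : PosetOfFields.{u, w} (Comp V))

instance isLocalHom_mapMatrix_augmentation {p : Type*} [Fintype p] [DecidableEq p] :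
    IsLocalHom ((augmentation K).mapMatrix : Matrix p p (PathSeries K) →+* _) :=
  isLocalHom_mapMatrix augmentation_surjective

/-- The canonical map `P_K(E) Σ⁻¹ → P_K((E))`. -/
noncomputable def toSeries : UnivLoc (pathAlgebra K) (sigmaSet K) →+* PathSeries K :=
  UnivLoc.lift (pathAlgebra K).subtype fun _ A hA =>
    isUnit_of_map_unit (augmentation K).mapMatrix (A.map (pathAlgebra K).subtype) hA

theorem toSeries_of (r : pathAlgebra K) : toSeries K (UnivLoc.of (sigmaSet K) r) = r :=
  UnivLoc.lift_of _ _ r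

/-- The embedding `𝓔 → P_K(E) Σ⁻¹`. -/
noncomputable def locDiag :
    (∀ x : V, K.fld (comp x)) →+* UnivLoc (pathAlgebra K) (sigmaSet K) :=
  (UnivLoc.of (sigmaSet K)).comp (diagAlg K)

theorem toSeries_locDiag (k : ∀ x : V, K.fld (comp x)) : toSeries K (locDiag K k) = diag K k :=
  toSeries_of K _

/-- The image in `P_K(E) Σ⁻¹` of the span of the edges. -/
noncomputable def locEdges : AddSubgroup (UnivLoc (pathAlgebra K) (sigmaSet K)) :=
  ((edgeSeries K).comap (pathAlgebra K).subtype.toAddMonoidHom).map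
    (UnivLoc.of (sigmaSet K)).toAddMonoidHom

theorem toSeries_mem_edgeSeries {b : UnivLoc (pathAlgebra K) (sigmaSet K)} (hb : b ∈ locEdges K) :
    toSeries K b ∈ edgeSeries K := by
  obtain ⟨a, ha, rfl⟩ := hb
  exact (toSeries_of K a).symm ▸ ha

variable {K}

theorem isUnit_map_of_of_augmentation {p : Type*} [Fintype p] [DecidableEq p]
    {A : Matrix p p (pathAlgebra K)}
    (hA : IsUnit (A.map ((augmentation K).comp (pathAlgebra K).subtype))) :
    IsUnit (A.map (UnivLoc.of (sigmaSet K))) := by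
  let e := Fintype.equivFin p
  have hmem : A.reindex e e ∈ sigmaSet K (Fintype.card p) := hA.map (reindexRingEquiv _ e)
  exact isUnit_of_map_unit (reindexRingEquiv _ e) _ (UnivLoc.isUnit_map_of hmem)

theorem exists_map_of_eq_of_mem_locEdges {p : Type*}
    {B : Matrix p p (UnivLoc (pathAlgebra K) (sigmaSet K))} (hB : ∀ i j, B i j ∈ locEdges K) :
    ∃ A : Matrix p p (pathAlgebra K), A.map (UnivLoc.of (sigmaSet K)) = B ∧
      ∀ i j, (A i j : PathSeries K) ∈ edgeSeries K := by
  choose A hA hAB using hB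
  exact ⟨Matrix.of A, by ext i j; exact hAB i j, hA⟩

theorem isUnit_one_sub_of_augmentation_eq_zero {p : Type*} [Fintype p] [DecidableEq p]
    {A : Matrix p p (pathAlgebra K)}
    (hA : A.map ((augmentation K).comp (pathAlgebra K).subtype) = 0) :
    IsUnit (1 - A.map (UnivLoc.of (sigmaSet K))) := by
  have hone : (1 - A).map ((augmentation K).comp (pathAlgebra K).subtype) = 1 := by
    rw [← RingHom.mapMatrix_apply, map_sub, map_one, RingHom.mapMatrix_apply, hA, sub_zero]
  rw [← RingHom.mapMatrix_apply, ← map_one (UnivLoc.of (sigmaSet K)).mapMatrix, ← map_sub]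
  exact isUnit_map_of_of_augmentation (hone ▸ isUnit_one)

variable (K) in
theorem isRadicalComplement_locEdges :
    IsRadicalComplement (locDiag K) ((augmentation K).comp (toSeries K)) (locEdges K) where
  map_map k := by rw [RingHom.comp_apply, toSeries_locDiag, augmentation_diag]
  map_eq_zero b hb := augmentation_eq_zero_of_mem_edgeSeries (toSeries_mem_edgeSeries K hb)
  mul_map_mem k b hb := by
    obtain ⟨a, ha, rfl⟩ := hb
    exact ⟨a * diagAlg K k, mul_diag_mem_edgeSeries ha k, (UnivLoc.of (sigmaSet K)).map_mul _ _⟩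
  isUnit_one_sub p _ _ B hB := by
    obtain ⟨A, rfl, hA⟩ := exists_map_of_eq_of_mem_locEdges hB
    exact isUnit_one_sub_of_augmentation_eq_zero <| Matrix.ext fun i j =>
      augmentation_eq_zero_of_mem_edgeSeries (hA i j)

theorem isRealizable_univLoc (t : UnivLoc (pathAlgebra K) (sigmaSet K)) :
    IsRealizable (locDiag K) (locEdges K) t := by
  have h := isRadicalComplement_locEdges K
  refine UnivLoc.map_mem_of_isRationallyClosed (φ := RingHom.id _) h.isRationallyClosed_realizable
    (fun r => ?_) t
  exact mem_of_pathAlgebra_generators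
    (U := (realizable (locDiag K) (locEdges K) h.mul_map_mem).comap (UnivLoc.of (sigmaSet K)))
    isRealizable_map (fun a ha => isRealizable_of_mem ⟨a, ha, rfl⟩) r

variable (K) in
theorem range_toSeries : (toSeries K).range = rationalClosure (pathAlgebra K) := by
  apply le_antisymm
  · rintro _ ⟨t, rfl⟩
    exact UnivLoc.map_mem_of_isRationallyClosed isRationallyClosed_rationalClosure
      (fun r => toSeries_of K r ▸ le_rationalClosure r.2) t
  · have hlocal : IsLocalHom ((augmentation K).comp (toSeries K)) := by
      refine ⟨fun t ht => ?_⟩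
      have h := isRadicalComplement_locEdges K
      have := h.isLocalHom_comp_subtype_realizable
      exact (isUnit_of_map_unit ((((augmentation K).comp (toSeries K))).comp
        (realizable _ _ h.mul_map_mem).subtype) ⟨t, isRealizable_univLoc t⟩ ht).map
        (realizable _ _ h.mul_map_mem).subtype
    refine rationalClosure_le (fun r hr => ⟨_, toSeries_of K ⟨r, hr⟩⟩)
      (isRationallyClosed_range (α := augmentation K) fun k => ⟨locDiag K k, ?_⟩)
    exact (isRadicalComplement_locEdges K).map_map k

end Localization

section Injectivity

open PathSeries Matrix

theorem exists_vecMul_projection {F : Type*} [Field F] {p : Type*} [Fintype p]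
    (U : Submodule F (p → F)) : ∃ P : Matrix p p F, (∀ i, P i ∈ U) ∧ ∀ u ∈ U, u ᵥ* P = u := by
  classical
  obtain ⟨π, hπ⟩ := U.subtype.exists_leftInverse_of_injective U.ker_subtype
  set P := LinearMap.toMatrixRight' (U.subtype ∘ₗ π) with hP
  have hvecMul (u : p → F) : u ᵥ* P = π u := by
    rw [← toLinearMapRight'_apply, hP, toLinearMapRight', LinearEquiv.symm_apply_apply]
    rfl
  refine ⟨P, fun i => ?_, fun u hu => ?_⟩
  · have hrow : π (Pi.single i 1) = P i := by rw [← hvecMul, single_one_vecMul, row]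
    exact hrow ▸ (π _).2
  · rw [hvecMul]
    exact congrArg Subtype.val (LinearMap.congr_fun hπ ⟨u, hu⟩)

variable {V : Type u} [Quiver.{v} V] [Preorder V] {K : PosetOfFields.{u, w} (Comp V)} {p : Type*}

/-- The span of the coefficients of the vector `w` of series at the paths that end at `y`. -/
def coeffSpan (w : p → PathSeries K) (y : V) :
    Submodule (K.fld (comp y)) (p → K.fld (comp y)) :=
  Submodule.span _ (Set.range fun γ : (Σ x : V, Quiver.Path x y) => fun j => w j γ.1 y γ.2)

theorem apply_mem_coeffSpan (w : p → PathSeries K) {x y : V} (γ : Quiver.Path x y) :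
    (fun j => w j x y γ) ∈ coeffSpan w y :=
  Submodule.subset_span ⟨⟨x, γ⟩, rfl⟩

/-- The coefficients of the matrix `B` at the edge `e`. -/
def edgeCoeff (B : Matrix p p (PathSeries K)) {x y : V} (e : x ⟶ y) :
    Matrix p p (K.fld (comp y)) :=
  B.map fun b => b x y (.cons .nil e)

variable [PathCompatible V] [Fintype p]

section Solution

variable {B : Matrix p p (PathSeries K)} (hB : ∀ i j, B i j ∈ edgeSeries K)
  {c : p → ∀ x : V, K.fld (comp x)} {w : p → PathSeries K} (hw : w = diag K ∘ c + w ᵥ* B)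

include hB hw

theorem apply_nil_of_solution (j : p) (y : V) : w j y y .nil = c j y := by
  have h : (w ᵥ* B) j y y .nil = 0 := by
    rw [vecMul, dotProduct, PathSeries.sum_apply]
    exact Finset.sum_eq_zero fun i _ => by
      rw [mul_apply_nil, apply_nil_of_mem_edgeSeries (hB i j), mul_zero]
  rw [hw, Pi.add_apply, PathSeries.add_apply, h, add_zero]
  rfl

theorem apply_cons_of_solution {x y z : V} (γ : Quiver.Path z x) (e : x ⟶ y) :
    (fun j => w j z y (γ.cons e)) =
      (fun j => K.incl (comp_le_of_path (Quiver.Path.nil.cons e)) (w j z x γ)) ᵥ*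
        edgeCoeff B e := by
  ext j
  conv_lhs => rw [hw]
  rw [Pi.add_apply, PathSeries.add_apply, Function.comp_apply, diag_cons, zero_add, vecMul,
    dotProduct, PathSeries.sum_apply]
  exact Finset.sum_congr rfl fun i _ => mul_edge_apply _ (hB i j) _ _

theorem const_mem_coeffSpan (y : V) : (fun j => c j y) ∈ coeffSpan w y := by
  simpa only [apply_nil_of_solution hB hw] using apply_mem_coeffSpan w (.nil : Quiver.Path y y)

theorem vecMul_edgeCoeff_mem_coeffSpan {x y : V} (e : x ⟶ y) {u : p → K.fld (comp x)}
    (hu : u ∈ coeffSpan w x) :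
    (K.incl (comp_le_of_path (Quiver.Path.nil.cons e)) ∘ u) ᵥ* edgeCoeff B e ∈
      coeffSpan w y := by
  set f := K.incl (comp_le_of_path (Quiver.Path.nil.cons e))
  induction hu using Submodule.span_induction with
  | mem u hu =>
    obtain ⟨⟨z, γ⟩, rfl⟩ := hu
    have h := apply_cons_of_solution hB hw γ e
    exact h ▸ apply_mem_coeffSpan w (γ.cons e)
  | zero =>
    have h : f ∘ (0 : p → K.fld (comp x)) = 0 := by ext; simp
    rw [h, zero_vecMul]
    exact zero_mem _
  | add u u' _ _ hu hu' =>
    have h : f ∘ (u + u') = f ∘ u + f ∘ u' := by ext; simp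
    rw [h, add_vecMul]
    exact add_mem hu hu'
  | smul a u _ hu =>
    have h : f ∘ (a • u) = f a • (f ∘ u) := by ext; simp
    rw [h, smul_vecMul]
    exact Submodule.smul_mem _ _ hu

end Solution

theorem dotProduct_eq_zero_of_mem_coeffSpan {d : p → ∀ x : V, K.fld (comp x)}
    {w : p → PathSeries K} (hwd : w ⬝ᵥ (diag K ∘ d) = 0) {y : V} {u : p → K.fld (comp y)}
    (hu : u ∈ coeffSpan w y) : u ⬝ᵥ (fun j => d j y) = 0 := by
  induction hu using Submodule.span_induction with
  | mem u hu =>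
    obtain ⟨⟨x, γ⟩, rfl⟩ := hu
    have h : (w ⬝ᵥ (diag K ∘ d)) x y γ = 0 := by rw [hwd, PathSeries.zero_apply]
    simpa only [dotProduct, Function.comp_apply, PathSeries.sum_apply, mul_diag_apply] using h
  | zero => exact zero_dotProduct _
  | add u u' _ _ hu hu' => rw [add_dotProduct, hu, hu', add_zero]
  | smul a u _ hu => rw [smul_dotProduct, hu, smul_zero]

/-- The matrix `E` projects, at each vertex `y`, onto `coeffSpan w y`. -/
theorem exists_invariant_projection {B : Matrix p p (PathSeries K)}
    (hB : ∀ i j, B i j ∈ edgeSeries K) {c d : p → ∀ x : V, K.fld (comp x)} {w : p → PathSeries K}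
    (hw : w = diag K ∘ c + w ᵥ* B) (hwd : w ⬝ᵥ (diag K ∘ d) = 0) :
    ∃ E : Matrix p p (∀ x : V, K.fld (comp x)), c ᵥ* E = c ∧ E *ᵥ d = 0 ∧
      E.map (diag K) * B * E.map (diag K) = E.map (diag K) * B := by
  choose P hP hPfix using fun y => exists_vecMul_projection (coeffSpan w y)
  refine ⟨Matrix.of fun i j y => P y i j, ?_, ?_, ?_⟩
  · ext j y
    rw [vecMul, dotProduct, Finset.sum_apply]
    exact congrFun (hPfix y _ (const_mem_coeffSpan hB hw y)) j
  · ext i y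
    rw [mulVec, dotProduct, Finset.sum_apply]
    exact dotProduct_eq_zero_of_mem_coeffSpan hwd (hP y i)
  · ext i k x y γ
    simp only [Matrix.mul_apply, PathSeries.sum_apply, Matrix.map_apply, mul_diag_apply,
      diag_mul_apply]
    by_cases hγ : γ.length = 1
    · obtain ⟨e, rfl⟩ := exists_eq_cons_nil_of_length_eq_one γ hγ
      exact congrFun (hPfix y _ (vecMul_edgeCoeff_mem_coeffSpan hB hw e (hP x i))) k
    · simp [hB _ _ _ _ _ hγ]

theorem dotProduct_locDiag_eq_zero [Finite V] {A : Matrix p p (pathAlgebra K)}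
    (hA : A.map ((augmentation K).comp (pathAlgebra K).subtype) = 0)
    {c d : p → ∀ x : V, K.fld (comp x)} {w : p → UnivLoc (pathAlgebra K) (sigmaSet K)}
    (hw : w = locDiag K ∘ c + w ᵥ* A.map (UnivLoc.of (sigmaSet K)))
    {E : Matrix p p (∀ x : V, K.fld (comp x))} (hcE : c ᵥ* E = c) (hEd : E *ᵥ d = 0)
    (hEAE : E.map (diag K) * A.map (pathAlgebra K).subtype * E.map (diag K) =
      E.map (diag K) * A.map (pathAlgebra K).subtype) :
    w ⬝ᵥ (locDiag K ∘ d) = 0 := by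
  classical
  have hEA : E.map (diagAlg K) * A * E.map (diagAlg K) = E.map (diagAlg K) * A := by
    refine Matrix.map_injective (f := (pathAlgebra K).subtype) Subtype.val_injective ?_
    simp only [Matrix.map_mul]
    exact hEAE
  have hEAaug : (E.map (diagAlg K) * A).map
      ((augmentation K).comp (pathAlgebra K).subtype) = 0 := by
    rw [Matrix.map_mul, hA, mul_zero]
  have hone_sub := isUnit_one_sub_of_augmentation_eq_zero hEAaug
  have hloc := congrArg (fun M => M.map (UnivLoc.of (sigmaSet K))) hEA
  simp only [Matrix.map_mul] at hone_sub hloc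
  refine dotProduct_eq_zero_of_invariant (E := E.map (locDiag K))
    (isUnit_one_sub_of_augmentation_eq_zero hA) hone_sub hw ?_ hloc ?_
  · ext j
    rw [← RingHom.map_vecMul, hcE, Function.comp_apply]
  · ext j
    rw [← RingHom.map_mulVec, hEd, Pi.zero_apply, map_zero, Pi.zero_apply]

variable (K) in
theorem toSeries_injective [Finite V] : Function.Injective (toSeries K) := by
  rw [injective_iff_map_eq_zero]
  intro t ht
  obtain ⟨p, _, B, c, d, w, hB, hw, rfl⟩ := isRealizable_univLoc t
  obtain ⟨A, rfl, hA⟩ := exists_map_of_eq_of_mem_locEdges hB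
  have hAaug : A.map ((augmentation K).comp (pathAlgebra K).subtype) = 0 :=
    Matrix.ext fun i j => augmentation_eq_zero_of_mem_edgeSeries (hA i j)
  have hcomp (q : p → ∀ x : V, K.fld (comp x)) : toSeries K ∘ locDiag K ∘ q = diag K ∘ q :=
    funext fun j => toSeries_locDiag K (q j)
  have hmap : (A.map (UnivLoc.of (sigmaSet K))).map (toSeries K) = A.map (pathAlgebra K).subtype :=
    Matrix.ext fun i j => toSeries_of K (A i j)
  have hws : toSeries K ∘ w = diag K ∘ c + (toSeries K ∘ w) ᵥ* A.map (pathAlgebra K).subtype := by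
    rw [← hmap, ← hcomp]
    ext j : 1
    rw [Pi.add_apply, ← RingHom.map_vecMul, Function.comp_apply, Function.comp_apply, ← map_add]
    exact congrArg (toSeries K) (congrFun hw j)
  rw [RingHom.map_dotProduct, hcomp] at ht
  obtain ⟨E, hcE, hEd, hEBE⟩ := exists_invariant_projection hA hws ht
  exact dotProduct_locDiag_eq_zero hAaug hw hcE hEd hEBE

end Injectivity

section Idempotents

open PathSeries

variable {V : Type u} [Quiver.{v} V] [Preorder V]

open Classical in
/-- The sum of the vertices whose class lies in `J`, an idempotent of `P_K((E))`. Multiplying by it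
on the left keeps the paths that start in `J`, and on the right those that end in `J`. -/
noncomputable def idem [PathCompatible V] (K : PosetOfFields.{u, w} (Comp V)) (J : Set (Comp V)) :
    PathSeries K :=
  diag K fun x => if comp x ∈ J then 1 else 0

variable [PathCompatible V] {K : PosetOfFields.{u, w} (Comp V)} {J J' : Set (Comp V)}

theorem idem_apply_nil_of_mem {x : V} (hx : comp x ∈ J) : idem K J x x .nil = 1 := by
  rw [idem, diag_nil, if_pos hx]

theorem idem_mul_apply_of_mem (a : PathSeries K) {x y : V} (hx : comp x ∈ J)
    (γ : Quiver.Path x y) : (idem K J * a) x y γ = a x y γ := by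
  rw [idem, diag_mul_apply, if_pos hx, map_one, one_mul]

theorem idem_mul_apply_of_notMem (a : PathSeries K) {x y : V} (hx : comp x ∉ J)
    (γ : Quiver.Path x y) : (idem K J * a) x y γ = 0 := by
  rw [idem, diag_mul_apply, if_neg hx, map_zero, zero_mul]

theorem mul_idem_apply_of_mem (a : PathSeries K) {x y : V} (hy : comp y ∈ J)
    (γ : Quiver.Path x y) : (a * idem K J) x y γ = a x y γ := by
  rw [idem, mul_diag_apply, if_pos hy, mul_one]

theorem mul_idem_apply_of_notMem (a : PathSeries K) {x y : V} (hy : comp y ∉ J)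
    (γ : Quiver.Path x y) : (a * idem K J) x y γ = 0 := by
  rw [idem, mul_diag_apply, if_neg hy, mul_zero]

theorem idem_univ : idem K Set.univ = 1 := by
  simp only [idem, Set.mem_univ, if_true]
  exact map_one (diag K)

theorem idem_mul_idem : idem K J * idem K J' = idem K (J ∩ J') := by
  rw [idem, idem, idem, ← map_mul]
  congr 1
  ext x
  by_cases hx : comp x ∈ J <;> by_cases hx' : comp x ∈ J' <;> simp [hx, hx']

theorem idem_mul_idem_of_subset (h : J ⊆ J') : idem K J' * idem K J = idem K J := by
  rw [idem_mul_idem, Set.inter_eq_right.2 h]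

theorem idem_mul_idem_of_disjoint (h : Disjoint J J') : idem K J * idem K J' = 0 := by
  rw [idem_mul_idem, h.inter_eq, idem]
  simp only [Set.mem_empty_iff_false, if_false]
  exact map_zero (diag K)

theorem idem_union (h : Disjoint J J') : idem K (J ∪ J') = idem K J + idem K J' := by
  rw [idem, idem, idem, ← map_add]
  congr 1
  ext x
  by_cases hx : comp x ∈ J
  · simp [hx, h.notMem_of_mem_left hx]
  · by_cases hx' : comp x ∈ J' <;> simp [hx, hx']

theorem idem_Iic (i : Comp V) : idem K (Set.Iic i) = idem K (Set.Iio i) + idem K {i} := by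
  rw [← Set.Iio_union_right, idem_union (by simp)]

/-- Paths descend, so those that start in a lower set `J` cannot leave it. -/
theorem idem_mul_mul_idem_eq_zero (hJ : IsLowerSet J) (h : Disjoint J J') (a : PathSeries K) :
    idem K J * a * idem K J' = 0 := by
  ext x y γ
  by_cases hx : comp x ∈ J
  · exact mul_idem_apply_of_notMem _ (h.notMem_of_mem_left (hJ (comp_le_of_path γ) hx)) γ
  · rw [mul_assoc, idem_mul_apply_of_notMem _ hx, PathSeries.zero_apply]

theorem sum_idem_mul [Fintype (Comp V)] (a : PathSeries K) : ∑ i, idem K {i} * a = a := by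
  ext x y γ
  rw [PathSeries.sum_apply, Finset.sum_eq_single_of_mem (comp x) (Finset.mem_univ _)]
  · exact idem_mul_apply_of_mem a (Set.mem_singleton _) γ
  · exact fun i _ hi => idem_mul_apply_of_notMem a (fun h => hi h.symm) γ

end Idempotents

section Extension

open PathSeries

variable {V : Type u} [Quiver.{v} V] [Preorder V] [PathCompatible V] {i : Comp V}

theorem Below.path_lift {x : V} (hx : comp x ≤ i) {y : V} (γ : Quiver.Path x y) :
    Below.path (Below.lift hx γ) = γ := by
  induction γ with
  | nil => rfl
  | cons p e ih => exact congrArg (Quiver.Path.cons · e) ih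

theorem Below.lift_path {x y : Below i} (γ : Quiver.Path x y) :
    Below.lift x.le (Below.path γ) = γ := by
  induction γ with
  | nil => rfl
  | cons p e ih => exact congrArg (Quiver.Path.cons · e) ih

theorem Below.splits_lift {x : V} (hx : comp x ≤ i) {y : V} (γ : Quiver.Path x y) :
    splits (Below.lift hx γ) = (splits γ).map fun s =>
      ⟨⟨s.1, (comp_le_of_path s.2.1).trans hx⟩, Below.lift hx s.2.1,
        Below.lift ((comp_le_of_path s.2.1).trans hx) s.2.2⟩ := by
  induction γ with
  | nil => rfl
  | cons p e ih =>
    simp only [Below.lift, splits, ih, List.map_cons, List.map_map]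
    rfl

variable (K : PosetOfFields.{u, w} (Comp V))

theorem extend_apply_of_le (a : FieldSeries (Below i) (K.fld i)) {x y : V} (hx : comp x ≤ i)
    (γ : Quiver.Path x y) : extend K i a x y γ = K.incl ((comp_le_of_path γ).trans hx)
      (show K.fld i from a ⟨x, hx⟩ ⟨y, (comp_le_of_path γ).trans hx⟩ (Below.lift hx γ)) :=
  dif_pos hx

theorem extend_apply_of_not_le (a : FieldSeries (Below i) (K.fld i)) {x y : V}
    (hx : ¬ comp x ≤ i) (γ : Quiver.Path x y) : extend K i a x y γ = 0 :=
  dif_neg hx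

theorem extend_mul (a b : FieldSeries (Below i) (K.fld i)) :
    extend K i (a * b) = extend K i a * extend K i b := by
  ext x y γ
  by_cases hx : comp x ≤ i
  · rw [extend_apply_of_le K _ hx, mul_apply, mul_apply, Below.splits_lift, List.map_map]
    refine (map_list_sum (K.incl ((comp_le_of_path γ).trans hx)) _).trans ?_
    refine (congrArg List.sum List.map_map).trans ?_
    refine congrArg List.sum (List.map_congr_left fun s _ => ?_)
    rw [extend_apply_of_le K _ hx, extend_apply_of_le K _ ((comp_le_of_path s.2.1).trans hx),
      K.incl_trans]
    exact map_mul (K.incl ((comp_le_of_path γ).trans hx)) _ _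
  · rw [extend_apply_of_not_le K _ hx, mul_apply, List.sum_eq_zero]
    intro c hc
    obtain ⟨s, -, rfl⟩ := List.mem_map.1 hc
    rw [extend_apply_of_not_le K _ hx, map_zero, zero_mul]

open Classical in
theorem extend_diag (k : Below i → K.fld i) :
    extend K i (diag (PosetOfFields.const _ (K.fld i)) k) =
      diag K fun x => if hx : comp x ≤ i then K.incl hx (k ⟨x, hx⟩) else 0 := by
  ext x y γ
  by_cases hx : comp x ≤ i
  · rw [extend_apply_of_le K _ hx]
    cases γ with
    | nil => rw [diag_nil, dif_pos hx]; rfl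
    | cons p e => exact map_zero (K.incl _)
  · rw [extend_apply_of_not_le K _ hx]
    cases γ with
    | nil => rw [diag_nil, dif_neg hx]
    | cons p e => rfl

open Classical in
theorem extend_one : extend K i 1 = idem K (Set.Iic i) := by
  rw [← map_one (diag (PosetOfFields.const _ (K.fld i)))]
  refine (extend_diag K 1).trans (congrArg (diag K) (funext fun x => ?_))
  simp only [Pi.one_apply, map_one, dite_eq_ite]
  exact if_congr (Set.mem_Iic (α := Comp V)).symm rfl rfl

theorem extend_single (p : Σ x y : Below i, Quiver.Path x y) :
    extend K i (single p) = single ⟨p.1.val, p.2.1.val, Below.path p.2.2⟩ := by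
  obtain ⟨x, y, γ⟩ := p
  ext x' y' γ'
  by_cases hx' : comp x' ≤ i
  · rw [extend_apply_of_le K _ hx', single_apply, single_apply]
    by_cases h : (⟨x', y', γ'⟩ : Σ x y : V, Quiver.Path x y) = ⟨x.val, y.val, Below.path γ⟩
    · cases h
      rw [if_pos rfl, if_pos (by rw [Below.lift_path])]
      exact map_one (K.incl _)
    · rw [if_neg h, if_neg]
      · exact map_zero (K.incl _)
      · rintro ⟨⟩
        exact h (by rw [Below.path_lift])
  · rw [extend_apply_of_not_le K _ hx', single_apply, if_neg]
    rintro ⟨⟩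
    exact hx' x.le

end Extension

section Corner

variable {S : Type u} [Ring S]

theorem IsDivisionClosed.mem_of_corner {T : Subring S} (hT : IsDivisionClosed T) {e x y : S}
    (he : e ∈ T) (hx : x ∈ T) (hex : e * x = x) (hxe : x * e = x) (hey : e * y = y)
    (hye : y * e = y) (hxy : x * y = e) (hyx : y * x = e) : y ∈ T := by
  have hee : e * e = e := by rw [← hxy, mul_assoc, ← mul_assoc y, hyx, hey]
  have hmem : y + (1 - e) ∈ T := by
    refine hT (x + (1 - e)) (add_mem hx (sub_mem (one_mem _) he)) _ ?_ ?_
    · simp only [mul_add, add_mul, mul_sub, sub_mul, mul_one, one_mul, hxy, hey, hxe, hee]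
      abel
    · simp only [mul_add, add_mul, mul_sub, sub_mul, mul_one, one_mul, hyx, hex, hye, hee]
      abel
  simpa using sub_mem hmem (sub_mem (one_mem _) he)

theorem divisionClosure_le {R T : Subring S} (hRT : R ≤ T) (hT : IsDivisionClosed T) :
    divisionClosure R ≤ T :=
  sInf_le ⟨hRT, hT⟩

theorem mul_mem_prodSpan {A B : AddSubgroup S} {a b : S} (ha : a ∈ A) (hb : b ∈ B) :
    a * b ∈ prodSpan A B :=
  AddSubgroup.subset_closure ⟨a, ha, b, hb, rfl⟩

theorem prodSpan_le {A B C : AddSubgroup S} (h : ∀ a ∈ A, ∀ b ∈ B, a * b ∈ C) :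
    prodSpan A B ≤ C := by
  rw [prodSpan, AddSubgroup.closure_le]
  rintro _ ⟨a, ha, b, hb, rfl⟩
  exact h a ha b hb

theorem prodSpan_mono_right (A : AddSubgroup S) {B B' : AddSubgroup S} (h : B ≤ B') :
    prodSpan A B ≤ prodSpan A B' :=
  prodSpan_le fun _ ha _ hb => mul_mem_prodSpan ha (h hb)

end Corner

theorem finite_comp {V : Type u} [Finite V] [Preorder V] : Finite (Comp V) :=
  inferInstanceAs (Finite (Quotient _))

section RationalSeries

open PathSeries

variable {V : Type u} [Quiver.{v} V] [Finite V] [Preorder V] [PathCompatible V]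
  {K : PosetOfFields.{u, w} (Comp V)} {J J' : Set (Comp V)} {i : Comp V}

theorem idem_mem_rationalClosure : idem K J ∈ rationalClosure (pathAlgebra K) :=
  le_rationalClosure (diag_mem_pathAlgebra _)

variable (K) in
/-- The elements of the rational closure of `P_K(E)` supported at the paths that start in `J`; this
turns out to be `P^rat_J(E)`. -/
noncomputable def ratOn (J : Set (Comp V)) : AddSubgroup (PathSeries K) where
  carrier := {a | a ∈ rationalClosure (pathAlgebra K) ∧ idem K J * a = a}
  add_mem' := fun ha hb => ⟨add_mem ha.1 hb.1, by rw [mul_add, ha.2, hb.2]⟩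
  zero_mem' := ⟨zero_mem _, mul_zero _⟩
  neg_mem' := fun ha => ⟨neg_mem ha.1, by rw [mul_neg, ha.2]⟩

theorem ratOn_univ : ratOn K Set.univ = (rationalClosure (pathAlgebra K)).toAddSubgroup := by
  ext a
  exact ⟨fun ha => ha.1, fun ha => ⟨ha, by rw [idem_univ, one_mul]⟩⟩

theorem ratOn_mono (h : J ⊆ J') : ratOn K J ≤ ratOn K J' := fun a ha =>
  ⟨ha.1, by rw [← ha.2, ← mul_assoc, idem_mul_idem_of_subset h]⟩

theorem mul_mem_ratOn {a b : PathSeries K} (ha : a ∈ ratOn K J)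
    (hb : b ∈ rationalClosure (pathAlgebra K)) : a * b ∈ ratOn K J :=
  ⟨mul_mem ha.1 hb, by rw [← mul_assoc, ha.2]⟩

theorem idem_mul_mem_ratOn {a : PathSeries K} (ha : a ∈ rationalClosure (pathAlgebra K)) :
    idem K J * a ∈ ratOn K J :=
  ⟨mul_mem idem_mem_rationalClosure ha, by rw [← mul_assoc, idem_mul_idem, Set.inter_self]⟩

theorem extend_mem_rationalClosure {a : FieldSeries (Below i) (K.fld i)}
    (ha : a ∈ fieldRat (Below i) (K.fld i)) : extend K i a ∈ rationalClosure (pathAlgebra K) := by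
  let T : Subring (FieldSeries (Below i) (K.fld i)) :=
    { (rationalClosure (pathAlgebra K)).toAddSubgroup.comap (extend K i) with
      mul_mem' := fun {a b} ha hb => by
        change extend K i (a * b) ∈ rationalClosure (pathAlgebra K)
        rw [extend_mul]
        exact mul_mem (S := Subring _) ha hb
      one_mem' := by
        change extend K i 1 ∈ rationalClosure (pathAlgebra K)
        rw [extend_one]
        exact idem_mem_rationalClosure }
  refine divisionClosure_le (T := T) (pathAlgebra_le (fun k => ?_) fun x y e => ?_)
    (fun b hb c hbc hcb => ?_) ha
  · change extend K i _ ∈ rationalClosure (pathAlgebra K)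
    exact extend_diag K k ▸ le_rationalClosure (diag_mem_pathAlgebra _)
  · change extend K i _ ∈ rationalClosure (pathAlgebra K)
    exact extend_single K _ ▸ le_rationalClosure (single_mem_pathAlgebra _)
  · refine isRationallyClosed_rationalClosure.isDivisionClosed.mem_of_corner
      (idem_mem_rationalClosure (J := Set.Iic i)) (x := extend K i b) hb ?_ ?_ ?_ ?_ ?_ ?_ <;>
    simp only [← extend_one, ← extend_mul, one_mul, mul_one, hbc, hcb]

theorem extend_mem_ratAt {a : FieldSeries (Below i) (K.fld i)}
    (ha : a ∈ fieldRat (Below i) (K.fld i)) : extend K i a ∈ ratAt K i := ⟨a, ha, rfl⟩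

theorem mul_mem_ratAt {a b : PathSeries K} (ha : a ∈ ratAt K i) (hb : b ∈ ratAt K i) :
    a * b ∈ ratAt K i := by
  obtain ⟨a, ha, rfl⟩ := ha
  obtain ⟨b, hb, rfl⟩ := hb
  exact extend_mul K a b ▸ extend_mem_ratAt (mul_mem ha hb)

theorem mul_idem_Iic {h : PathSeries K} (hh : h ∈ ratAt K i) : h * idem K (Set.Iic i) = h := by
  obtain ⟨a, -, rfl⟩ := hh
  rw [← extend_one, ← extend_mul, mul_one]

theorem ratAt_le_ratOn : ratAt K i ≤ ratOn K (Set.Iic i) := by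
  rintro _ ⟨a, ha, rfl⟩
  exact ⟨extend_mem_rationalClosure ha, by rw [← extend_one, ← extend_mul, one_mul]⟩

theorem idem_Iic_mem_ratAt : idem K (Set.Iic i) ∈ ratAt K i :=
  extend_one K ▸ extend_mem_ratAt (one_mem _)

theorem idem_singleton_mul_diag_mem_ratAt (k : ∀ x : V, K.fld (comp x)) :
    idem K {i} * diag K k ∈ ratAt K i := by
  classical
  let k' (x : Below i) : K.fld i := if hx : i ≤ comp x.val then K.incl hx (k x.val) else 0
  have h : extend K i (diag (PosetOfFields.const _ (K.fld i)) k') = idem K {i} * diag K k := by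
    refine (extend_diag K k').trans ?_
    rw [idem, ← map_mul]
    congr 1
    ext x
    by_cases hx : comp x = i
    · subst hx
      simp [k', K.incl_refl]
    · by_cases hxi : comp x ≤ i
      · simp [k', hx, hxi, show ¬ i ≤ comp x from fun h => hx (le_antisymm hxi h)]
      · simp [hx, hxi]
  exact h ▸ extend_mem_ratAt (le_divisionClosure (diag_mem_pathAlgebra _))

theorem idem_singleton_mem_ratAt : idem K {i} ∈ ratAt K i := by
  simpa only [map_one, mul_one] using idem_singleton_mul_diag_mem_ratAt (K := K) (i := i) 1

theorem single_mem_ratAt {x y : V} (hx : comp x ≤ i) (γ : Quiver.Path x y) :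
    single ⟨x, y, γ⟩ ∈ ratAt K i := by
  have h := extend_single K ⟨⟨x, hx⟩, ⟨y, (comp_le_of_path γ).trans hx⟩, Below.lift hx γ⟩
  rw [Below.path_lift] at h
  exact h ▸ extend_mem_ratAt (le_divisionClosure (single_mem_pathAlgebra _))

theorem exists_mem_ratAt_mul_eq_idem_Iic {h : PathSeries K} (hh : h ∈ ratAt K i)
    (hne : ∀ x : V, comp x ≤ i → h x x .nil ≠ 0) :
    ∃ g ∈ ratAt K i, g * h = idem K (Set.Iic i) := by
  obtain ⟨a, ha, rfl⟩ := hh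
  have hunit : IsUnit a := by
    refine isUnit_of_map_unit (augmentation _) a
      (Pi.isUnit_iff.2 fun x => IsUnit.mk0 _ fun h0 => ?_)
    refine hne x.val x.le ((extend_apply_of_le K a x.le .nil).trans ?_)
    exact (congrArg _ h0).trans (map_zero _)
  obtain ⟨b, hab, hba⟩ := isUnit_iff_exists.1 hunit
  exact ⟨extend K i b, extend_mem_ratAt (isDivisionClosed_divisionClosure a ha b hab hba),
    by rw [← extend_mul, hba, extend_one]⟩

section RatBlock

variable (K i) in
/-- The part `P^rat_{K_i}(E_{I↓i}) + P^rat_{K_i}(E_{I↓i}) P^rat_J(E)` of the inductive step, for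
the smallest possible `J`, that of the elements below `i`. -/
noncomputable def ratBlock : AddSubgroup (PathSeries K) :=
  ratAt K i ⊔ prodSpan (ratAt K i) (ratOn K (Set.Iio i))

theorem ratAt_le_ratBlock : ratAt K i ≤ ratBlock K i := le_sup_left

theorem ratBlock_le {C : AddSubgroup (PathSeries K)} (hC : ratAt K i ≤ C)
    (hmul : ∀ h ∈ ratAt K i, ∀ l ∈ ratOn K (Set.Iio i), h * l ∈ C) : ratBlock K i ≤ C :=
  sup_le hC (prodSpan_le hmul)

theorem ratAt_mul_mem_ratBlock {h m : PathSeries K} (hh : h ∈ ratAt K i)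
    (hm : m ∈ ratBlock K i) : h * m ∈ ratBlock K i := by
  refine ratBlock_le (C := (ratBlock K i).comap (AddMonoidHom.mulLeft h))
    (fun g hg => ratAt_le_ratBlock (mul_mem_ratAt hh hg)) (fun g hg l hl => ?_) hm
  change h * (g * l) ∈ ratBlock K i
  rw [← mul_assoc]
  exact le_sup_right (α := AddSubgroup _) (mul_mem_prodSpan (mul_mem_ratAt hh hg) hl)

theorem mul_mem_ratBlock {m b : PathSeries K} (hm : m ∈ ratBlock K i)
    (hb : b ∈ rationalClosure (pathAlgebra K)) (hib : idem K {i} * b ∈ ratBlock K i) :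
    m * b ∈ ratBlock K i := by
  have hmul {h l : PathSeries K} (hh : h ∈ ratAt K i) (hl : l ∈ ratOn K (Set.Iio i)) :
      h * l ∈ ratBlock K i :=
    le_sup_right (α := AddSubgroup _) (mul_mem_prodSpan hh hl)
  refine ratBlock_le (C := (ratBlock K i).comap (AddMonoidHom.mulRight b))
    (fun h hh => ?_) (fun h hh l hl => ?_) hm
  · have hsplit : h * b = h * (idem K (Set.Iio i) * b) + h * (idem K {i} * b) := by
      rw [← mul_add, ← add_mul, ← idem_Iic, ← mul_assoc, mul_idem_Iic hh]
    change h * b ∈ ratBlock K i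
    exact hsplit ▸ add_mem (hmul hh (idem_mul_mem_ratOn hb)) (ratAt_mul_mem_ratBlock hh hib)
  · change h * l * b ∈ ratBlock K i
    exact mul_assoc h l b ▸ hmul hh (mul_mem_ratOn hl hb)

theorem mul_idem_singleton_mem_ratAt {m : PathSeries K} (hm : m ∈ ratBlock K i) :
    m * idem K {i} ∈ ratAt K i := by
  refine ratBlock_le (C := (ratAt K i).comap (AddMonoidHom.mulRight (idem K {i})))
    (fun h hh => mul_mem_ratAt hh idem_singleton_mem_ratAt) (fun h _ l hl => ?_) hm
  have hzero : l * idem K {i} = 0 := by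
    rw [← hl.2, idem_mul_mul_idem_eq_zero (isLowerSet_Iio i) (by simp)]
  change h * l * idem K {i} ∈ ratAt K i
  rw [mul_assoc, hzero, mul_zero]
  exact zero_mem _

/-- The diagonal block of `a` at `i`, completed by the idempotent of the classes below `i`, has
invertible augmentation, hence an inverse in `P^rat_{K_i}(E_{I↓i})`. -/
theorem exists_mem_ratAt_mul_idem_mul_idem {a : PathSeries K} (ha : IsUnit a)
    (hia : idem K {i} * a ∈ ratBlock K i) :
    ∃ g ∈ ratAt K i, g * (idem K {i} * a * idem K {i}) = idem K {i} := by
  have hdisj : Disjoint (Set.Iio i) {i} := by simp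
  have hIio : idem K (Set.Iio i) ∈ ratAt K i := by
    rw [← add_sub_cancel_right (idem K (Set.Iio i)) (idem K {i}), ← idem_Iic]
    exact sub_mem idem_Iic_mem_ratAt idem_singleton_mem_ratAt
  have hne (x : V) (hx : comp x ≤ i) :
      (idem K {i} * a * idem K {i} + idem K (Set.Iio i)) x x .nil ≠ 0 := by
    rw [PathSeries.add_apply]
    obtain hx | hx := lt_or_eq_of_le hx
    · rw [mul_idem_apply_of_notMem _ hx.ne, idem_apply_nil_of_mem hx, zero_add]
      exact one_ne_zero
    · rw [mul_idem_apply_of_mem _ hx, idem_mul_apply_of_mem _ hx, idem, diag_nil,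
        if_neg (by simp [hx]), add_zero]
      exact (Pi.isUnit_iff.1 (ha.map (augmentation K)) x).ne_zero
  obtain ⟨g, hg, hgu⟩ := exists_mem_ratAt_mul_eq_idem_Iic
    (add_mem (mul_idem_singleton_mem_ratAt hia) hIio) hne
  refine ⟨g, hg, ?_⟩
  have h := congrArg (· * idem K {i}) hgu
  simpa only [mul_assoc, add_mul, idem_mul_idem, Set.inter_self, idem_mul_idem_of_disjoint hdisj,
    add_zero, idem_mul_idem_of_subset (Set.singleton_subset_iff.2 Set.self_mem_Iic)] using h

/-- Writing `q` for the idempotent at `i` and `g` for the inverse of `q a q`, the relation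
`g q (a b) = g q` gives `q b = g q - g (q a) (1 - q) b`. -/
theorem idem_singleton_mul_inverse_mem_ratBlock {a b : PathSeries K} (hab : a * b = 1)
    (hba : b * a = 1) (hb : b ∈ rationalClosure (pathAlgebra K))
    (hia : idem K {i} * a ∈ ratBlock K i) : idem K {i} * b ∈ ratBlock K i := by
  obtain ⟨g, hg, hga⟩ :=
    exists_mem_ratAt_mul_idem_mul_idem (isUnit_iff_exists.2 ⟨b, hab, hba⟩) hia
  set q := idem K {i}
  have hqb : q * b = g * q - g * (q * a * (b - q * b)) := by
    calc q * b = g * (q * a * q) * b := by rw [hga]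
      _ = g * q * (a * b) - g * (q * a * (b - q * b)) := by noncomm_ring
      _ = g * q - g * (q * a * (b - q * b)) := by rw [hab, mul_one]
  have hq : q * (b - q * b) = 0 := by
    rw [mul_sub, ← mul_assoc, idem_mul_idem, Set.inter_self, sub_self]
  rw [hqb]
  refine sub_mem (ratAt_le_ratBlock (mul_mem_ratAt hg idem_singleton_mem_ratAt))
    (ratAt_mul_mem_ratBlock hg (mul_mem_ratBlock hia ?_ (hq ▸ zero_mem _)))
  exact sub_mem hb (mul_mem idem_mem_rationalClosure hb)

variable (K i) in
/-- The rational series whose part starting in the class `i` lies in `ratBlock K i`. -/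
noncomputable def ratBlockSubring : Subring (PathSeries K) where
  carrier := {a | a ∈ rationalClosure (pathAlgebra K) ∧ idem K {i} * a ∈ ratBlock K i}
  mul_mem' := fun ha hb =>
    ⟨mul_mem ha.1 hb.1, mul_assoc (idem K {i}) _ _ ▸ mul_mem_ratBlock ha.2 hb.1 hb.2⟩
  one_mem' := ⟨one_mem _, by
    rw [mul_one]
    exact ratAt_le_ratBlock idem_singleton_mem_ratAt⟩
  add_mem' := fun ha hb => ⟨add_mem ha.1 hb.1, by
    rw [mul_add]
    exact add_mem ha.2 hb.2⟩
  zero_mem' := ⟨zero_mem _, by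
    rw [mul_zero]
    exact zero_mem _⟩
  neg_mem' := fun ha => ⟨neg_mem ha.1, by
    rw [mul_neg]
    exact neg_mem ha.2⟩

theorem diag_mem_ratBlockSubring (k : ∀ x : V, K.fld (comp x)) :
    diag K k ∈ ratBlockSubring K i :=
  ⟨le_rationalClosure (diag_mem_pathAlgebra k),
    ratAt_le_ratBlock (idem_singleton_mul_diag_mem_ratAt k)⟩

theorem single_mem_ratBlockSubring {x y : V} (γ : Quiver.Path x y) :
    single ⟨x, y, γ⟩ ∈ ratBlockSubring K i := by
  refine ⟨le_rationalClosure (single_mem_pathAlgebra _), ?_⟩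
  by_cases hx : comp x = i
  · exact ratAt_le_ratBlock (mul_mem_ratAt idem_singleton_mem_ratAt (single_mem_ratAt hx.le γ))
  · have hzero : idem K {i} * single ⟨x, y, γ⟩ = 0 := by
      ext x' y' γ'
      by_cases hx' : comp x' = i
      · rw [idem_mul_apply_of_mem _ hx', single_apply, if_neg, PathSeries.zero_apply]
        rintro ⟨⟩
        exact hx hx'
      · exact idem_mul_apply_of_notMem _ hx' γ'
    exact hzero ▸ zero_mem _

theorem isDivisionClosed_ratBlockSubring : IsDivisionClosed (ratBlockSubring K i) := by
  intro a ha b hab hba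
  have hb := isRationallyClosed_rationalClosure.isDivisionClosed a ha.1 b hab hba
  exact ⟨hb, idem_singleton_mul_inverse_mem_ratBlock hab hba hb ha.2⟩

theorem idem_singleton_mul_mem_ratBlock {a : PathSeries K}
    (ha : a ∈ rationalClosure (pathAlgebra K)) : idem K {i} * a ∈ ratBlock K i :=
  (rationalClosure_le
    (pathAlgebra_le diag_mem_ratBlockSubring fun _ _ _ => single_mem_ratBlockSubring _)
    (isRationallyClosed_of_isDivisionClosed isDivisionClosed_ratBlockSubring
      diag_mem_ratBlockSubring) ha).2

theorem ratBlock_eq_ratAt (hi : IsMin i) : ratBlock K i = ratAt K i := by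
  refine le_antisymm (ratBlock_le le_rfl fun h _ l hl => ?_) ratAt_le_ratBlock
  have hzero : l = 0 := by
    rw [← hl.2, hi.Iio_eq]
    ext x y γ
    exact idem_mul_apply_of_notMem l (Set.notMem_empty _) γ
  rw [hzero, mul_zero]
  exact zero_mem _

end RatBlock

theorem iSup_ratAt_eq_ratOn (hJ : ∀ i ∈ J, IsMin i) : ⨆ i ∈ J, ratAt K i = ratOn K J := by
  apply le_antisymm
  · refine iSup₂_le fun i hi => ratAt_le_ratOn.trans (ratOn_mono ?_)
    rwa [(hJ i hi).Iic_eq, Set.singleton_subset_iff]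
  · intro a ha
    have := finite_comp (V := V)
    have := Fintype.ofFinite (Comp V)
    rw [← sum_idem_mul a]
    refine sum_mem fun i _ => ?_
    by_cases hi : i ∈ J
    · have h := idem_singleton_mul_mem_ratBlock (i := i) ha.1
      rw [ratBlock_eq_ratAt (hJ i hi)] at h
      exact AddSubgroup.mem_iSup_of_mem i (AddSubgroup.mem_iSup_of_mem hi h)
    · rw [← ha.2, ← mul_assoc, idem_mul_idem_of_disjoint (Set.disjoint_singleton_left.2 hi),
        zero_mul]
      exact zero_mem _

theorem ratAt_sup_prodSpan_sup_eq_ratOn (hi : Minimal (fun j => j ∉ J) i) :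
    ratAt K i ⊔ prodSpan (ratAt K i) (ratOn K J) ⊔ ratOn K J = ratOn K (J ∪ {i}) := by
  have hIio : Set.Iio i ⊆ J := fun j hj => not_not.1 (hi.not_prop_of_lt hj)
  have hat : ratAt K i ≤ ratOn K (J ∪ {i}) := ratAt_le_ratOn.trans <| ratOn_mono <| by
    rw [← Set.Iio_union_right]
    exact Set.union_subset_union_left _ hIio
  apply le_antisymm
  · exact sup_le (sup_le hat (prodSpan_le fun a ha b hb => mul_mem_ratOn (hat ha) hb.1))
      (ratOn_mono Set.subset_union_left)
  · intro a ha
    have hsplit : a = idem K {i} * a + idem K J * a := by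
      rw [← add_mul, add_comm, ← idem_union (Set.disjoint_singleton_right.2 hi.prop), ha.2]
    rw [hsplit]
    exact AddSubgroup.add_mem_sup (sup_le_sup_left (prodSpan_mono_right _ (ratOn_mono hIio)) _
      (idem_singleton_mul_mem_ratBlock ha.1)) (idem_mul_mem_ratOn ha.1)

theorem IsRat.eq_ratOn {P : AddSubgroup (PathSeries K)} (h : IsRat K J P) : P = ratOn K J := by
  induction h with
  | base J _ hmin => exact iSup_ratAt_eq_ratOn hmin
  | step J _ _ i hi P _ ih => rw [ih, ratAt_sup_prodSpan_sup_eq_ratOn hi]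

theorem isRat_ratOn (hne : J.Nonempty) (hlow : IsLowerSet J) : IsRat K J (ratOn K J) := by
  have := finite_comp (V := V)
  induction J using WellFoundedLT.induction with
  | ind J ih =>
    by_cases hmin : ∀ i ∈ J, IsMin i
    · exact iSup_ratAt_eq_ratOn (K := K) hmin ▸ .base J hne hmin
    push Not at hmin
    obtain ⟨k, hk, hkmin⟩ := hmin
    obtain ⟨j, hjk⟩ := not_isMin_iff.1 hkmin
    obtain ⟨i, hki, hi⟩ := J.toFinite.exists_le_maximal hk
    have hlow_erase : IsLowerSet (J \ {i}) :=
      IsLowerSet.erase hlow fun b hb hib => hi.eq_of_ge hb hib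
    have hne_erase : (J \ {i}).Nonempty := ⟨j, hlow hjk.le hk, (hjk.trans_le hki).ne⟩
    have hminimal : Minimal (fun l => l ∉ J \ {i}) i :=
      ⟨fun h => h.2 rfl, fun l hl hli => ((not_and_not_right.1 hl) (hlow hli hi.prop)).ge⟩
    have hstep := IsRat.step _ hne_erase hlow_erase i hminimal _
      (ih _ (Set.sdiff_singleton_ssubset.2 hi.prop) hne_erase hlow_erase)
    rwa [ratAt_sup_prodSpan_sup_eq_ratOn hminimal,
      Set.sdiff_union_of_subset (Set.singleton_subset_iff.2 hi.prop)] at hstep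

end RationalSeries

end PosetFields

open PosetFields in
theorem mainTheorem3_general {V : Type u} [Quiver.{v} V] [Finite V] [Nonempty V] [Preorder V]
    [PathCompatible V] (K : PosetOfFields.{u, w} (Comp V)) :
    ∃ Prat : Subring (PathSeries K),
      (∀ P : AddSubgroup (PathSeries K), IsRat K Set.univ P ↔ P = Prat.toAddSubgroup) ∧
      Prat = rationalClosure (pathAlgebra K) ∧
      ∃ φ : UnivLoc (pathAlgebra K) (sigmaSet K) →+* Prat,
        (∀ r : pathAlgebra K, (φ (UnivLoc.of (sigmaSet K) r) : PathSeries K) = r) ∧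
        (∀ ψ : UnivLoc (pathAlgebra K) (sigmaSet K) →+* Prat,
          (∀ r : pathAlgebra K, (ψ (UnivLoc.of (sigmaSet K) r) : PathSeries K) = r) → ψ = φ) ∧
        Function.Bijective φ := by
  refine ⟨rationalClosure (pathAlgebra K), fun P => ?_, rfl, ?_⟩
  · have : Nonempty (Comp V) := Nonempty.map comp ‹_›
    rw [← ratOn_univ]
    exact ⟨IsRat.eq_ratOn, fun h => h ▸ isRat_ratOn Set.univ_nonempty isLowerSet_univ⟩
  · rw [← range_toSeries]
    refine ⟨(toSeries K).rangeRestrict, toSeries_of K, fun ψ hψ => ?_, ?_,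
      (toSeries K).rangeRestrict_surjective⟩
    · exact UnivLoc.ringHom_ext fun r => Subtype.ext ((hψ r).trans (toSeries_of K r).symm)
    · exact fun s t h => toSeries_injective K (congrArg Subtype.val h)

open PosetFields in
theorem mainTheorem3 {V : Type u} [Quiver.{v} V] [Finite V] [∀ x y : V, Finite (x ⟶ y)]
    [Preorder V] [PathCompatible V] (hI : IsTreePoset (Comp V))
    (K : PosetOfFields.{u, w} (Comp V)) :
    ∃ Prat : Subring (PathSeries K),
      -- `Prat` is `P^rat_K(E)`: the one and only value of `P^rat_J(E)` at `J = I`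
      (∀ P : AddSubgroup (PathSeries K), IsRat K Set.univ P ↔ P = Prat.toAddSubgroup) ∧
      -- it is the rational closure of `P_K(E)` in `P_K((E))`
      Prat = rationalClosure (pathAlgebra K) ∧
      -- the natural map `P_K(E) Σ⁻¹ → P^rat_K(E)` is an isomorphism
      ∃ φ : UnivLoc (pathAlgebra K) (sigmaSet K) →+* Prat,
        (∀ r : pathAlgebra K, (φ (UnivLoc.of (sigmaSet K) r) : PathSeries K) = r) ∧
        (∀ ψ : UnivLoc (pathAlgebra K) (sigmaSet K) →+* Prat,
          (∀ r : pathAlgebra K, (ψ (UnivLoc.of (sigmaSet K) r) : PathSeries K) = r) → ψ = φ) ∧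
        Function.Bijective φ := by
  obtain ⟨i₀, -⟩ := hI
  have : Nonempty V := ⟨ofAntisymmetrization _ i₀⟩
  exact mainTheorem3_general K
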